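/- Let $\mathbb M$ be a finite non-empty set of phases and let $\{D_k\}_{k\ge 0}$ be real $\mathbb M\times\mathbb M$ matrices characterizing a batch Markovian arrival process (BMAP): $D_k\ge O$ for $k\ge 1$, the off-diagonal elements of $D_0$ are nonnegative, $D:=\sum_{k\ge 0}D_k$ converges and is an irreducible generator with $De=0$, and $D_k\ne O$ for some $k\ge1$ (here $e$ is the column vector of ones, and $\mathrm e$ is Napier's constant). Let $\mu>0$ and consider the BMAP/M/$\infty$ queue with service rate $\mu$, i.e. the generator $Q=(q(k,i;\ell,j))$ on $\mathbb S=\mathbb Z_+\times\mathbb M$ with blocks $$Q_{k,\ell}=D_{\ell-k}\ (\ell>k),\qquad Q_{k,k}=D_0-k\mu I,\qquad Q_{k,k-1}=k\mu I\ (k\ge1),\qquad Q_{k,\ell}=O\ (\ell<k-1).$$ Suppose that for some $C>0$ $$\sum_{k=1}^{\infty}(k+\mathrm e)\log(k+\mathrm e)\,D_k e< C e ,$$ and put $V(x)=(x+\mathrm e)\log(x+\mathrm e)$ for $x\ge 0$ and, for $c>0$, $v^{(c)}(k,i)=c\log(k+\mathrm e)$, so that $v^{(c)}_k=c\log(k+\mathrm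 e)\,e$. Then: 1. (Drift.) There are $K\in\mathbb Z_+$ and $\theta>0$ such that, with convergent series, $$\sum_{\ell=0}^{\infty}Q_{k,\ell}V(\ell)e\le-\theta V(k)e\le -e\qquad\text{for all }k\ge K+1.$$ 2. (Condition 1.) $Q$ is irreducible, and for every $c$ with $c\mu>1$ (in particular for $c=1$ if $\mu>1$) the vector $v=v^{(c)}$ satisfies $\inf v>0$ and $Qv\le -e+b\,1_{\mathbb C}$ for some $b\in(0,\infty)$ and some finite set $\mathbb C\subset\mathbb S$. 3. (Condition 2.) There is exactly one probability vector $\pi$ on $\mathbb S$ with $\pi Q=0$; it is positive, and for every $c>0$ (in particular for $v_k=\log(k+\mathrm e)e$) $$\sum_{(k,i)\in\mathbb S}\pi(k,i)\,|q(k,i;k,i)|\,v^{(c)}(k,i)<\infty .$$ 4. (The algorithm applies.) Let $c>0$ and $v=v^{(c)}$. Define recursively $$U^*_{0,0}=U_0^*=(-Q_{0,0})^{-1},\qquad U_n^*=U^*_{n,n}=\Bigl(-Q_{n,n}-Q_{n,n-1}\sum_{\ell=0}^{n-1}U^*_{n-1,\ell}Q_{\ell,n}\Bigr)^{-1},\qquad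 U^*_{n,k}=U^*_nQ_{n,n-1}U^*_{n-1,k}\ (k<n),$$ $$u_0^*=U_0^*e,\qquad u_n^*=U_n^*(e+Q_{n,n-1}u^*_{n-1}),\qquad y_n=v_n+\sum_{k=0}^nU^*_{n,k}\sum_{\ell=n+1}^\infty Q_{k,\ell}v_\ell .$$ All these inverses exist, the series in $y_n$ converge, and $u_n^*>0$, $y_n>0$. For any choice of $j_n^*\in\operatorname{argmin}_{j\in\mathbb M}y_n(j)/u_n^*(j)$, $n\ge0$, let ${}_{(n)}\hat\pi^*$ be the vector on $\mathbb S$ whose level-$k$ part is the $j_n^*$-th row of $U^*_{n,k}$ divided by $u_n^*(j_n^*)$ for $k\le n$, and zero for $k>n$. Then each ${}_{(n)}\hat\pi^*$ is a probability vector and $$\lim_{n\to\infty}\|{}_{(n)}\hat\pi^*-\pi\|=0,\qquad \|m\|:=\sum_x|m(x)| .$$ Consequently, for each $\varepsilon\in(0,1)$ and each strictly increasing sequence $n_0<n_1<\cdots$ of positive integers, the stopping criterion $\|{}_{(n_\ell)}\hat\pi^*-{}_{(n_{\ell-1})}\hat\pi^*\|<\varepsilon$ is met for some $\ell\ge1$.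 -/

import Mathlib

open Filter Topology

noncomputable section

namespace BlockHessenberg

/-- Irreducibility of a (generator) matrix `q`: every state reaches every other state along
transitions `a → b`, `a ≠ b`, of positive rate. -/
def IsIrreducibleGenerator {S : Type*} (q : S → S → ℝ) : Prop :=
  ∀ x y : S, Relation.ReflTransGen (fun a b => a ≠ b ∧ 0 < q a b) x y

/-- `p` is a probability vector with `p q = 0`. -/
structure IsStationaryDistribution {S : Type*} (q : S → S → ℝ) (p : S → ℝ) : Prop where
  nonneg : ∀ x, 0 ≤ p x
  hasSum_one : HasSum p 1
  balance : ∀ y, HasSum (fun x => p x * q x y) 0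

/-- Foster-Lyapunov drift condition with the vector `v`: the generator `q` is irreducible, `v` is
positive and bounded away from zero, and `q v ≤ -e + b 1_C` for some `b > 0` and some finite
set `C` of states (where the series in `q v` converge). -/
structure DriftCondition {S : Type*} (q : S → S → ℝ) (v : S → ℝ) : Prop where
  irreducible : IsIrreducibleGenerator q
  inf_pos : ∃ δ : ℝ, 0 < δ ∧ ∀ x, δ ≤ v x
  summable : ∀ x, Summable (fun y => q x y * v y)
  drift : ∃ b : ℝ, 0 < b ∧ ∃ C : Finset S, ∀ x,
    ∑' y, q x y * v y ≤ -1 + b * Set.indicator (C : Set S) (fun _ => (1 : ℝ)) x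

/-- Moment condition `∑ₙ πₙ Δₙ vₙ < ∞`, where `Δ` is the diagonal matrix of the `|q x x|`. -/
def MomentCondition {S : Type*} (q : S → S → ℝ) (p v : S → ℝ) : Prop :=
  Summable (fun x => p x * |q x x| * v x)

section Algorithm

variable {ι : Type*} [Fintype ι] [DecidableEq ι]

/-- The matrix on `ℕ × ι` (level, phase) with blocks `Q k l`. -/
def ofBlocks (Q : ℕ → ℕ → Matrix ι ι ℝ) : ℕ × ι → ℕ × ι → ℝ :=
  fun x y => Q x.1 y.1 x.2 y.2

/-- `-Q_{n+1,n+1} - Q_{n+1,n} ∑_{l ≤ n} U_l Q_{l,n+1}`. -/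
def pivotOf (Q : ℕ → ℕ → Matrix ι ι ℝ) (n : ℕ) (U : ℕ → Matrix ι ι ℝ) : Matrix ι ι ℝ :=
  -Q (n + 1) (n + 1) - Q (n + 1) n * ∑ l ∈ Finset.range (n + 1), U l * Q l (n + 1)

/-- The matrices `U*_{n,k}`, `0 ≤ k ≤ n` (and `0` for `k > n`); `U*_n` is `U*_{n,n}`. -/
def Ustar (Q : ℕ → ℕ → Matrix ι ι ℝ) : ℕ → ℕ → Matrix ι ι ℝ
  | 0, k => if k = 0 then (-Q 0 0)⁻¹ else 0
  | n + 1, k =>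
      if k = n + 1 then (pivotOf Q n (Ustar Q n))⁻¹
      else if k ≤ n then (pivotOf Q n (Ustar Q n))⁻¹ * Q (n + 1) n * Ustar Q n k
      else 0

/-- The matrix that is inverted in step `n` of the algorithm to get `U*_n`. -/
def pivot (Q : ℕ → ℕ → Matrix ι ι ℝ) : ℕ → Matrix ι ι ℝ
  | 0 => -Q 0 0
  | n + 1 => pivotOf Q n (Ustar Q n)

/-- `u*_0 = U*_0 e` and `u*_n = U*_n (e + Q_{n,n-1} u*_{n-1})`. -/
def uStar (Q : ℕ → ℕ → Matrix ι ι ℝ) : ℕ → ι → ℝ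
  | 0 => (Ustar Q 0 0).mulVec (fun _ => 1)
  | n + 1 => (Ustar Q (n + 1) (n + 1)).mulVec
      ((fun _ => 1) + (Q (n + 1) n).mulVec (uStar Q n))

/-- The terms `Q_{k,l} v_l`, `l = n+1+m`, of the tail series `∑_{l > n} Q_{k,l} v_l`. -/
def tailTerm (Q : ℕ → ℕ → Matrix ι ι ℝ) (v : ℕ × ι → ℝ) (n k m : ℕ) : ι → ℝ :=
  (Q k (n + 1 + m)).mulVec (fun j => v (n + 1 + m, j))

/-- `y_n = v_n + ∑_{k ≤ n} U*_{n,k} ∑_{l > n} Q_{k,l} v_l`. -/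
def yVec (Q : ℕ → ℕ → Matrix ι ι ℝ) (v : ℕ × ι → ℝ) (n : ℕ) (i : ι) : ℝ :=
  v (n, i) + ∑ k ∈ Finset.range (n + 1),
    (Ustar Q n k).mulVec (fun j => ∑' m, tailTerm Q v n k m j) i

/-- `j n` minimises `y_n / u*_n` over the phases, for every `n`. -/
def IsArgmin (Q : ℕ → ℕ → Matrix ι ι ℝ) (v : ℕ × ι → ℝ) (j : ℕ → ι) : Prop :=
  ∀ n i, yVec Q v n (j n) / uStar Q n (j n) ≤ yVec Q v n i / uStar Q n i

/-- The approximation computed by the algorithm at truncation level `n`: on level `k ≤ n` it is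
row `j n` of `U*_{n,k}` divided by `u*_n (j n)`, and it is zero above level `n`. -/
def approx (Q : ℕ → ℕ → Matrix ι ι ℝ) (j : ℕ → ι) (n : ℕ) : ℕ × ι → ℝ :=
  fun x => if x.1 ≤ n then Ustar Q n x.1 (j n) x.2 / uStar Q n (j n) else 0

/-- Total variation norm `∑ |p x - p' x|` of the difference of two summable vectors. -/
def tvDist {S : Type*} (p p' : S → ℝ) : ℝ := ∑' x, |p x - p' x|

/-- The sequential update algorithm, run with the vector `v` on the generator with blocks `Q`,
works and computes `p`: every step is well defined; whatever minimisers `j n` are chosen,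
the computed vectors are probability vectors that converge to `p` in total variation, and for each
tolerance `ε` and each sequence `N` of check points the stopping criterion is met. -/
structure AlgorithmApplies (Q : ℕ → ℕ → Matrix ι ι ℝ) (v p : ℕ × ι → ℝ) : Prop where
  isUnit_pivot : ∀ n, IsUnit (pivot Q n)
  uStar_pos : ∀ n i, 0 < uStar Q n i
  tail_summable : ∀ n k i, k ≤ n → Summable (fun m => tailTerm Q v n k m i)
  yVec_pos : ∀ n i, 0 < yVec Q v n i
  approx_nonneg : ∀ j, IsArgmin Q v j → ∀ n x, 0 ≤ approx Q j n x
  approx_hasSum : ∀ j, IsArgmin Q v j → ∀ n, HasSum (approx Q j n) 1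
  converges : ∀ j, IsArgmin Q v j →
    Tendsto (fun n => tvDist (approx Q j n) p) atTop (𝓝 0)
  terminates : ∀ j, IsArgmin Q v j → ∀ ε : ℝ, 0 < ε → ε < 1 →
    ∀ N : ℕ → ℕ, StrictMono N → (∀ l, 0 < N l) →
      ∃ l, 1 ≤ l ∧ tvDist (approx Q j (N l)) (approx Q j (N (l - 1))) < ε

end Algorithm

section BMAP

variable {ι : Type*} [Fintype ι] [DecidableEq ι]

/-- `D` characterises a batch Markovian arrival process with phase set `ι`: `D_k ≥ 0` for `k ≥ 1`,
`D_0` is nonnegative off the diagonal, `∑_k D_k` converges and is an irreducible conservative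
generator, and batches do arrive. -/
structure IsBMAP (D : ℕ → Matrix ι ι ℝ) : Prop where
  nonneg : ∀ k, 1 ≤ k → ∀ i j, 0 ≤ D k i j
  offDiag_nonneg : ∀ i j, i ≠ j → 0 ≤ D 0 i j
  summable : ∀ i j, Summable (fun k => D k i j)
  conservative : ∀ i, ∑ j, ∑' k, D k i j = 0
  irreducible : IsIrreducibleGenerator (fun i j => ∑' k, D k i j)
  arrivals : ∃ k, 1 ≤ k ∧ D k ≠ 0

/-- Blocks `Q_{k,l}` of the generator of the BMAP/M/∞ queue with service rate `μ`. -/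
def bmapBlocks (D : ℕ → Matrix ι ι ℝ) (μ : ℝ) (k l : ℕ) : Matrix ι ι ℝ :=
  if k < l then D (l - k)
  else if k = l then D 0 - ((k : ℝ) * μ) • (1 : Matrix ι ι ℝ)
  else if k = l + 1 then ((k : ℝ) * μ) • (1 : Matrix ι ι ℝ)
  else 0

/-- `V(x) = (x + e) log (x + e)`. -/
def lyapV (x : ℝ) : ℝ := (x + Real.exp 1) * Real.log (x + Real.exp 1)

/-- The vector with `v(k,i) = c log (k + e)`. -/
def logVec (c : ℝ) : ℕ × ι → ℝ := fun x => c * Real.log ((x.1 : ℝ) + Real.exp 1)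

end BMAP

end BlockHessenberg

end

/-! The blocks `Ustar Q n k`, `k ≤ n`, form the last block row of the inverse of minus the
truncation of `Q` to levels at most `n`: `∑ k, U k * Q k l` is `-1` for `l = n` and `0` for `l < n`.
A normalised row is therefore a probability vector satisfying all balance equations below level `n`.
The pivots are invertible with nonnegative inverse by a minimum principle (`isUnit_and_inv_nonneg`).

Testing this identity against `V l - V n`, with `V(x) = (x + e) log (x + e)`, gives uniform control.
At level `k` departures push `V` down by at least `kμ log (k + e)`, while the moment hypothesis
bounds the effect of arrivals by `3C log (k + e)`. This drift survives truncation, so the `V`-means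
of all approximations share one bound, whichever rows are selected (`tsum_approx_mul_le`).

That bound gives tightness. Every ultrafilter limit of approximations is then a stationary
distribution with finite `V`-mean. Since the diagonal rates grow linearly, finite `V`-mean implies
finite total rate, which makes the stationary distribution unique
(`IsStationaryDistribution.unique`). All limits thus coincide, convergence is pointwise, and
Scheffé's lemma upgrades it to total variation. The same `V`-mean dominates rate times logarithm,
which is the moment condition. -/

namespace BlockHessenberg

/-! ### Finite matrices: minimum principle and nonnegative inverses. -/

section Generic

/-- A family on `ℕ × ι` with finite `ι` can be summed phase by phase. -/
theorem hasSum_prod_of_phases {ι : Type*} [Fintype ι] [DecidableEq ι] {g : ℕ × ι → ℝ} {s : ι → ℝ}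
    (h : ∀ j, HasSum (fun l => g (l, j)) (s j)) : HasSum g (∑ j, s j) := by
  have h1 : ∀ j, HasSum (fun x : ℕ × ι => if x.2 = j then g x else 0) (s j) := by
    intro j
    have hinj : Function.Injective (fun l : ℕ => (l, j)) := fun a b hab => by simpa using hab
    rw [← hinj.hasSum_iff]
    · simpa [Function.comp_def] using h j
    · rintro ⟨l, i⟩ hx
      have : i ≠ j := by
        rintro rfl
        exact hx ⟨l, rfl⟩
      simp [this]
  have h2 := hasSum_sum (s := Finset.univ) (fun j _ => h1 j)
  simpa using h2

variable {ι : Type*} [Fintype ι]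

theorem mulVec_apply_nonneg {A : Matrix ι ι ℝ} {i : ι} (hA : ∀ j, 0 ≤ A i j) {w : ι → ℝ}
    (hw : ∀ j, 0 ≤ w j) : 0 ≤ A.mulVec w i :=
  Finset.sum_nonneg fun j _ => mul_nonneg (hA j) (hw j)

theorem mulVec_apply_mono {A : Matrix ι ι ℝ} {i : ι} (hA : ∀ j, 0 ≤ A i j) {w z : ι → ℝ}
    (h : ∀ j, w j ≤ z j) : A.mulVec w i ≤ A.mulVec z i :=
  Finset.sum_le_sum fun j _ => mul_le_mul_of_nonneg_left (h j) (hA j)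

/-- Minimum principle for a weakly diagonally dominant matrix with nonpositive off-diagonal
entries, every state of which is chained to a row with positive sum. -/
theorem nonneg_of_mulVec_nonneg {A : Matrix ι ι ℝ} (hoff : ∀ i j, i ≠ j → A i j ≤ 0)
    (hrow : ∀ i, 0 ≤ ∑ j, A i j)
    (hpath : ∀ i, ∃ j, Relation.ReflTransGen (fun a b => a ≠ b ∧ A a b < 0) i j ∧
      0 < ∑ k, A j k)
    {z : ι → ℝ} (hz : ∀ i, 0 ≤ A.mulVec z i) (i : ι) : 0 ≤ z i := by
  by_contra! hi
  have : Nonempty ι := ⟨i⟩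
  obtain ⟨i₀, hmin⟩ := Finite.exists_min z
  have hneg : z i₀ < 0 := (hmin i).trans_lt hi
  -- At a negative minimum, `A z` is `z a` times the row sum plus weighted differences, all
  -- nonpositive; since `A z ≥ 0` they vanish. So the minimum spreads along the chain until it meets
  -- a positive row sum.
  have key : ∀ a, z a = z i₀ → (∑ k, A a k) ≤ 0 ∧ ∀ b, a ≠ b → A a b < 0 → z b = z i₀ := by
    intro a ha
    have hterm : ∀ b ∈ Finset.univ, A a b * (z b - z a) ≤ 0 := by
      intro b _
      by_cases hab : a = b
      · simp [hab]
      · exact mul_nonpos_of_nonpos_of_nonneg (hoff a b hab) (by have := hmin b; linarith)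
    have hsplit : A.mulVec z a = z a * ∑ k, A a k + ∑ k, A a k * (z k - z a) := by
      simp only [Matrix.mulVec, dotProduct, Finset.mul_sum, ← Finset.sum_add_distrib]
      exact Finset.sum_congr rfl fun k _ => by ring
    have h1 := hz a
    rw [hsplit] at h1
    have h2 := Finset.sum_nonpos hterm
    have h3 : z a * ∑ k, A a k ≤ 0 :=
      mul_nonpos_of_nonpos_of_nonneg (by linarith) (hrow a)
    refine ⟨?_, fun b hab hA => ?_⟩
    · by_contra! hpos
      have : z a * ∑ k, A a k < 0 := mul_neg_of_neg_of_pos (by linarith) hpos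
      linarith
    · have h4 : ∑ k, A a k * (z k - z a) = 0 := by linarith
      have h5 := (Finset.sum_eq_zero_iff_of_nonpos hterm).1 h4 b (Finset.mem_univ b)
      rcases mul_eq_zero.1 h5 with h | h <;> linarith
  obtain ⟨j, hj, hpos⟩ := hpath i₀
  have hzj : z j = z i₀ := by
    clear hpos
    induction hj with
    | refl => rfl
    | tail _ hbc ih => exact (key _ ih).2 _ hbc.1 hbc.2
  exact absurd (key j hzj).1 (not_le.2 hpos)

variable [DecidableEq ι]

/-- The minimum principle applied to `z - w` and `w - z` gives injectivity; applied to the columns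
of `A⁻¹` it gives their sign. -/
theorem isUnit_and_inv_nonneg {A : Matrix ι ι ℝ} (hoff : ∀ i j, i ≠ j → A i j ≤ 0)
    (hrow : ∀ i, 0 ≤ ∑ j, A i j)
    (hpath : ∀ i, ∃ j, Relation.ReflTransGen (fun a b => a ≠ b ∧ A a b < 0) i j ∧
      0 < ∑ k, A j k) :
    IsUnit A ∧ ∀ i j, 0 ≤ A⁻¹ i j := by
  have hmp := fun {z : ι → ℝ} => nonneg_of_mulVec_nonneg (z := z) hoff hrow hpath
  have hA : IsUnit A := by
    rw [← Matrix.mulVec_injective_iff_isUnit]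
    intro z w hzw
    have h0 : A.mulVec (z - w) = 0 := by rw [Matrix.mulVec_sub]; exact sub_eq_zero.2 hzw
    have h0' : A.mulVec (w - z) = 0 := by rw [Matrix.mulVec_sub]; exact sub_eq_zero.2 hzw.symm
    funext i
    have h1 := hmp (z := z - w) (fun i => by simp [h0]) i
    have h2 := hmp (z := w - z) (fun i => by simp [h0']) i
    simp only [Pi.sub_apply] at h1 h2
    linarith
  refine ⟨hA, fun i j => ?_⟩
  have h := hmp (z := A⁻¹.mulVec (Pi.single j 1)) (fun i => by
    rw [Matrix.mulVec_mulVec, Matrix.mul_nonsing_inv _ ((Matrix.isUnit_iff_isUnit_det _).1 hA),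
      Matrix.one_mulVec]
    by_cases h : i = j
    · subst h; simp
    · simp [h]) i
  simpa using h

theorem inv_rowSum_pos {A : Matrix ι ι ℝ} (hA : IsUnit A) (hinv : ∀ i j, 0 ≤ A⁻¹ i j) (i : ι) :
    0 < ∑ j, A⁻¹ i j := by
  refine lt_of_le_of_ne (Finset.sum_nonneg fun j _ => hinv i j) fun h => ?_
  have h0 := (Finset.sum_eq_zero_iff_of_nonneg fun j _ => hinv i j).1 h.symm
  have h1 : (A⁻¹ * A) i i = 1 := by
    rw [Matrix.nonsing_inv_mul _ ((Matrix.isUnit_iff_isUnit_det _).1 hA), Matrix.one_apply_eq]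
  rw [Matrix.mul_apply, Finset.sum_eq_zero fun j _ => by rw [h0 j (Finset.mem_univ j), zero_mul]]
    at h1
  exact zero_ne_one h1

end Generic

/-! ### Invariant vectors of irreducible generators. -/

section Uniqueness

variable {S : Type*} {q : S → S → ℝ}

/-- A nonnegative invariant vector of an irreducible generator vanishes as soon as one of its
components does. -/
theorem eq_zero_of_apply_eq_zero (hoff : ∀ x y, x ≠ y → 0 ≤ q x y)
    (hirr : IsIrreducibleGenerator q) {m : S → ℝ} (hm : ∀ x, 0 ≤ m x)
    (hbal : ∀ y, HasSum (fun x => m x * q x y) 0) {y : S} (hy : m y = 0) (x : S) : m x = 0 := by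
  have step : ∀ a b, a ≠ b ∧ 0 < q a b → m b = 0 → m a = 0 := by
    rintro a b ⟨hab, hq⟩ hb
    have hnn : ∀ x, 0 ≤ m x * q x b := by
      intro x
      by_cases hx : x = b
      · simp [hx, hb]
      · exact mul_nonneg (hm x) (hoff x b hx)
    have h0 := (hasSum_zero_iff_of_nonneg hnn).1 (hbal b)
    have h1 : m a * q a b = 0 := congrFun h0 a
    rcases mul_eq_zero.1 h1 with h | h
    · exact h
    · exact absurd h hq.ne'
  have hxy := hirr x y
  induction hxy using Relation.ReflTransGen.head_induction_on with
  | refl => exact hy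
  | head hab _ ih => exact step _ _ hab ih

theorem pos_of_isStationaryDistribution (hoff : ∀ x y, x ≠ y → 0 ≤ q x y)
    (hirr : IsIrreducibleGenerator q) {p : S → ℝ} (hp : IsStationaryDistribution q p) (x : S) :
    0 < p x := by
  refine lt_of_le_of_ne (hp.nonneg x) fun h => ?_
  have h0 : p = 0 := funext fun z =>
    eq_zero_of_apply_eq_zero hoff hirr hp.nonneg hp.balance h.symm z
  have h1 := hp.hasSum_one
  rw [h0] at h1
  exact zero_ne_one (hasSum_zero.unique h1)

theorem hasSum_abs_row (hoff : ∀ x y, x ≠ y → 0 ≤ q x y) (hrow : ∀ x, HasSum (q x) 0) (x : S) :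
    HasSum (fun y => |q x y|) (2 * |q x x|) := by
  classical
  have hdiag : q x x ≤ 0 := by
    have h : ∀ y, y ≠ x → 0 ≤ q x y := fun y hy => hoff x y hy.symm
    have := sum_le_hasSum {x} (fun y hy => h y (by simpa using hy)) (hrow x)
    simpa using this
  have h1 : HasSum (fun y => if y = x then 2 * |q x x| else 0) (2 * |q x x|) :=
    hasSum_ite_eq x _
  have h2 := (hrow x).add h1
  rw [zero_add] at h2
  convert h2 using 2 with y
  by_cases hy : y = x
  · subst hy
    simp only [abs_of_nonpos hdiag, if_true]
    ring
  · simp [hy, abs_of_nonneg (hoff x y (Ne.symm hy))]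

/-- A summable nonnegative vector with `m q ≤ 0` and finite total rate is invariant. -/
theorem balance_of_subinvariant (hoff : ∀ x y, x ≠ y → 0 ≤ q x y) (hrow : ∀ x, HasSum (q x) 0)
    {m : S → ℝ} (hm : ∀ x, 0 ≤ m x) (hrate : Summable fun x => m x * |q x x|)
    (hsub : ∀ y, ∑' x, m x * q x y ≤ 0) (y : S) : HasSum (fun x => m x * q x y) 0 := by
  -- Finite total rate makes the double series absolutely convergent. By Fubini the column sums add
  -- up to zero, so being nonpositive they all vanish.
  have hs : Summable (fun z : S × S => m z.1 * q z.1 z.2) := by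
    refine Summable.of_abs ?_
    rw [summable_prod_of_nonneg (fun z => abs_nonneg _)]
    refine ⟨fun x => ?_, ?_⟩
    · simp only [abs_mul]
      exact ((hasSum_abs_row hoff hrow x).mul_left |m x|).summable
    · have : (fun x => ∑' y, |m x * q x y|) = fun x => 2 * (m x * |q x x|) := by
        funext x
        simp only [abs_mul]
        rw [((hasSum_abs_row hoff hrow x).mul_left |m x|).tsum_eq, abs_of_nonneg (hm x)]
        ring
      exact this ▸ hrate.mul_left 2
  have hs' : Summable (fun z : S × S => m z.2 * q z.2 z.1) := hs.prod_symm
  have hcol : ∀ y, Summable (fun x => m x * q x y) := fun y => hs'.prod_factor y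
  have htot : ∑' y, ∑' x, m x * q x y = 0 := by
    have h1 : ∑' x, ∑' y, m x * q x y = 0 := by
      have : ∀ x, ∑' y, m x * q x y = 0 := fun x => by
        rw [((hrow x).mul_left (m x)).tsum_eq, mul_zero]
      simp [this]
    rw [← h1]
    exact hs.tsum_comm
  have hcs : Summable (fun y => ∑' x, m x * q x y) := hs'.prod
  have hneg : HasSum (fun y => -∑' x, m x * q x y) 0 := by
    have := hcs.hasSum.neg
    rwa [htot, neg_zero] at this
  have h0 := congrFun ((hasSum_zero_iff_of_nonneg fun y => neg_nonneg.2 (hsub y)).1 hneg) y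
  have h1 : ∑' x, m x * q x y = 0 := neg_eq_zero.1 h0
  exact h1 ▸ (hcol y).hasSum

/-- Uniqueness of the stationary distribution when one of finite total rate exists. -/
theorem IsStationaryDistribution.unique (hoff : ∀ x y, x ≠ y → 0 ≤ q x y)
    (hrow : ∀ x, HasSum (q x) 0) (hirr : IsIrreducibleGenerator q) {p p' : S → ℝ}
    (hp : IsStationaryDistribution q p) (hp' : IsStationaryDistribution q p')
    (hr : Summable fun x => p x * |q x x|) : p = p' := by
  classical
  -- The minimum of two invariant vectors is subinvariant and inherits the finite total rate of `p`,
  -- hence is itself invariant.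
  set m : S → ℝ := fun x => min (p x) (p' x) with hmdef
  have hm : ∀ x, 0 ≤ m x := fun x => le_min (hp.nonneg x) (hp'.nonneg x)
  have hrate : Summable fun x => m x * |q x x| :=
    Summable.of_nonneg_of_le (fun x => mul_nonneg (hm x) (abs_nonneg _))
      (fun x => mul_le_mul_of_nonneg_right (min_le_left _ _) (abs_nonneg _)) hr
  have aux : ∀ {a : S → ℝ}, IsStationaryDistribution q a → (∀ x, m x ≤ a x) → ∀ y, m y = a y →
      ∑' x, m x * q x y ≤ 0 := by
    intro a ha hle y hy
    by_cases hsum : Summable (fun x => m x * q x y)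
    · rw [← (ha.balance y).tsum_eq]
      refine hsum.tsum_le_tsum (fun x => ?_) (ha.balance y).summable
      by_cases hx : x = y
      · rw [hx, hy]
      · exact mul_le_mul_of_nonneg_right (hle x) (hoff x y hx)
    -- A divergent column has the default sum `0`, which suffices here; summability of columns is
    -- recovered in `balance_of_subinvariant`.
    · rw [tsum_eq_zero_of_not_summable hsum]
  have hsub : ∀ y, ∑' x, m x * q x y ≤ 0 := by
    intro y
    rcases le_total (p y) (p' y) with h | h
    · exact aux hp (fun x => min_le_left _ _) y (min_eq_left h)
    · exact aux hp' (fun x => min_le_right _ _) y (min_eq_right h)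
  have hbal := balance_of_subinvariant hoff hrow hm hrate hsub
  -- The invariant vector `a - m` vanishes at `y`, hence everywhere; so `a = m ≤ a'`, and equal
  -- total mass forces `a = a'`.
  have fin : ∀ {a a' : S → ℝ}, IsStationaryDistribution q a → IsStationaryDistribution q a' →
      (∀ x, m x ≤ a x) → (∀ x, m x ≤ a' x) → ∀ y, m y = a y → a = a' := by
    intro a a' ha ha' hle hle' y hy
    have h0 : ∀ x, a x - m x = 0 := fun x =>
      eq_zero_of_apply_eq_zero (m := fun x => a x - m x) hoff hirr
        (fun x => sub_nonneg.2 (hle x))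
        (fun y => by simpa [sub_mul] using (ha.balance y).sub (hbal y)) (y := y)
        (by simp [hy]) x
    have h1 : ∀ x, a x ≤ a' x := fun x => by have := h0 x; have := hle' x; linarith
    have h2 := ha'.hasSum_one.sub ha.hasSum_one
    rw [sub_self] at h2
    have h3 := (hasSum_zero_iff_of_nonneg fun x => sub_nonneg.2 (h1 x)).1 h2
    funext x
    have : a' x - a x = 0 := congrFun h3 x
    linarith
  obtain ⟨y⟩ : Nonempty S := by
    by_contra hne
    rw [not_nonempty_iff] at hne
    exact zero_ne_one (hasSum_empty.unique hp.hasSum_one)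
  rcases le_total (p y) (p' y) with h | h
  · exact fin hp hp' (fun x => min_le_left _ _) (fun x => min_le_right _ _) y (min_eq_left h)
  · exact (fin hp' hp (fun x => min_le_right _ _) (fun x => min_le_left _ _) y
      (min_eq_right h)).symm

end Uniqueness

/-! ### Block elimination for upper block-Hessenberg generators. -/

section BlockAlgebra

variable {ι : Type*} [Fintype ι] [DecidableEq ι]

/-- The blocks `Q k l` form an upper block-Hessenberg generator all of whose north-west corners
are transient. -/
structure IsHessenbergGenerator (Q : ℕ → ℕ → Matrix ι ι ℝ) : Prop where
  eq_zero : ∀ k l, l + 1 < k → Q k l = 0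
  nonneg_of_ne : ∀ k l, k ≠ l → ∀ i j, 0 ≤ Q k l i j
  offDiag_nonneg : ∀ k i j, i ≠ j → 0 ≤ Q k k i j
  partialRowSum_nonpos : ∀ n k, k ≤ n → ∀ i,
    ∑ l ∈ Finset.range (n + 1), (Q k l).mulVec (fun _ => 1) i ≤ 0
  escape : ∀ n i, ∃ j, Relation.ReflTransGen (fun a b => a ≠ b ∧ 0 < Q n n a b) i j ∧
    ∑ l ∈ Finset.range (n + 1), (Q n l).mulVec (fun _ => 1) j < 0

theorem Ustar_self (Q : ℕ → ℕ → Matrix ι ι ℝ) (n : ℕ) : Ustar Q n n = (pivot Q n)⁻¹ := by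
  cases n <;> simp [Ustar, pivot]

theorem Ustar_succ_of_le (Q : ℕ → ℕ → Matrix ι ι ℝ) {n k : ℕ} (h : k ≤ n) :
    Ustar Q (n + 1) k = (pivot Q (n + 1))⁻¹ * Q (n + 1) n * Ustar Q n k := by
  have : k ≠ n + 1 := by omega
  simp [Ustar, pivot, this, h]

theorem Ustar_of_lt (Q : ℕ → ℕ → Matrix ι ι ℝ) {n k : ℕ} (h : n < k) : Ustar Q n k = 0 := by
  cases n with
  | zero =>
    have : k ≠ 0 := by omega
    simp [Ustar, this]
  | succ n =>
    have h1 : k ≠ n + 1 := by omega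
    have h2 : ¬ k ≤ n := by omega
    simp [Ustar, h1, h2]

variable {Q : ℕ → ℕ → Matrix ι ι ℝ}

/-- The new pivot inverse factors out of every column. What remains cancels at `l = n` by induction,
is zero for `l < n` by the Hessenberg shape, and is minus the pivot at `l = n + 1`. -/
theorem sum_Ustar_mul_succ (h0 : ∀ k l, l + 1 < k → Q k l = 0) {n : ℕ}
    (hu : IsUnit (pivot Q (n + 1)))
    (ih : ∀ l ≤ n, ∑ k ∈ Finset.range (n + 1), Ustar Q n k * Q k l = if l = n then -1 else 0) :
    ∀ l ≤ n + 1, ∑ k ∈ Finset.range (n + 1 + 1), Ustar Q (n + 1) k * Q k l =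
      if l = n + 1 then -1 else 0 := by
  intro l hl
  have hstep : ∑ k ∈ Finset.range (n + 1 + 1), Ustar Q (n + 1) k * Q k l =
      (pivot Q (n + 1))⁻¹ *
        (Q (n + 1) l + Q (n + 1) n * ∑ k ∈ Finset.range (n + 1), Ustar Q n k * Q k l) := by
    rw [Finset.sum_range_succ, Ustar_self, add_comm, mul_add, Finset.mul_sum, Finset.mul_sum]
    congr 1
    refine Finset.sum_congr rfl fun k hk => ?_
    rw [Ustar_succ_of_le Q (by simpa [Nat.lt_succ_iff] using hk)]
    simp only [Matrix.mul_assoc]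
  rw [hstep]
  rcases Nat.lt_or_ge l (n + 1) with hlt | hge
  · rw [ih l (by omega), if_neg (by omega : l ≠ n + 1)]
    by_cases hln : l = n
    · subst hln
      simp
    · rw [if_neg hln, h0 (n + 1) l (by omega)]
      simp
  · obtain rfl : l = n + 1 := by omega
    have : Q (n + 1) (n + 1) + Q (n + 1) n * ∑ k ∈ Finset.range (n + 1),
        Ustar Q n k * Q k (n + 1) = -pivot Q (n + 1) := by
      simp only [pivot, pivotOf]
      abel
    rw [this, mul_neg, Matrix.nonsing_inv_mul _ ((Matrix.isUnit_iff_isUnit_det _).1 hu),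
      if_pos rfl]

theorem sum_Ustar_mulVec_of_sum_mul {n : ℕ}
    (h : ∀ l ≤ n, ∑ k ∈ Finset.range (n + 1), Ustar Q n k * Q k l = if l = n then -1 else 0)
    (w : ℕ → ι → ℝ) :
    ∑ k ∈ Finset.range (n + 1),
      (Ustar Q n k).mulVec (∑ l ∈ Finset.range (n + 1), (Q k l).mulVec (w l)) = -w n := by
  have h1 : ∀ l ∈ Finset.range (n + 1),
      ∑ k ∈ Finset.range (n + 1), (Ustar Q n k).mulVec ((Q k l).mulVec (w l)) =
        if l = n then -w n else 0 := by
    intro l hl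
    simp only [Matrix.mulVec_mulVec]
    rw [← Matrix.sum_mulVec, h l (by simpa [Nat.lt_succ_iff] using hl)]
    split_ifs with hln
    · rw [Matrix.neg_mulVec, Matrix.one_mulVec, hln]
    · rw [Matrix.zero_mulVec]
  simp only [Matrix.mulVec_sum]
  rw [Finset.sum_comm, Finset.sum_congr rfl h1]
  simp

namespace IsHessenbergGenerator

variable (hQ : IsHessenbergGenerator Q)
include hQ

/-- The matrix `B` holds the phase probabilities on first passage from level `n` to level `n + 1`,
and is substochastic. The pivot is thus minus a subgenerator: its row sums dominate the loss of the
truncated row, and it keeps the within-level transitions used by `escape`. -/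
theorem isUnit_pivot_succ {n : ℕ} (hnn : ∀ k i j, 0 ≤ Ustar Q n k i j)
    (h : ∀ l ≤ n, ∑ k ∈ Finset.range (n + 1), Ustar Q n k * Q k l = if l = n then -1 else 0) :
    IsUnit (pivot Q (n + 1)) ∧ ∀ i j, 0 ≤ (pivot Q (n + 1))⁻¹ i j := by
  set B : Matrix ι ι ℝ := ∑ l ∈ Finset.range (n + 1), Ustar Q n l * Q l (n + 1) with hB
  have hUQ : ∀ l ∈ Finset.range (n + 1), ∀ i j, 0 ≤ (Ustar Q n l * Q l (n + 1)) i j := by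
    intro l hl i j
    have hne : l ≠ n + 1 := by
      have := Finset.mem_range.1 hl
      omega
    rw [Matrix.mul_apply]
    exact Finset.sum_nonneg fun a _ => mul_nonneg (hnn l i a) (hQ.nonneg_of_ne _ _ hne a j)
  have hBnn : ∀ i j, 0 ≤ B i j := fun i j => by
    rw [hB, Matrix.sum_apply]
    exact Finset.sum_nonneg fun l hl => hUQ l hl i j
  have hQd : ∀ i j, 0 ≤ Q (n + 1) n i j := hQ.nonneg_of_ne _ _ (by omega)
  -- Against the constant `1`, the inverse identity gives `-1`; adding column `n + 1` turns the row
  -- sums into those of the next truncation, which are nonpositive.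
  have hBe : ∀ i, B.mulVec (fun _ => 1) i ≤ 1 := by
    intro i
    have h1 := congrFun (sum_Ustar_mulVec_of_sum_mul h (fun _ _ => 1)) i
    rw [Finset.sum_apply] at h1
    have h2 : B.mulVec (fun _ => 1) i =
        ∑ l ∈ Finset.range (n + 1),
          (Ustar Q n l).mulVec ((Q l (n + 1)).mulVec (fun _ => 1)) i := by
      rw [hB, Matrix.sum_mulVec, Finset.sum_apply]
      simp only [Matrix.mulVec_mulVec]
    have h3 : (∑ l ∈ Finset.range (n + 1),
        (Ustar Q n l).mulVec ((Q l (n + 1)).mulVec (fun _ => 1)) i) +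
        ∑ k ∈ Finset.range (n + 1), (Ustar Q n k).mulVec
          (∑ l ∈ Finset.range (n + 1), (Q k l).mulVec (fun _ => 1)) i ≤ 0 := by
      rw [← Finset.sum_add_distrib]
      refine Finset.sum_nonpos fun l hl => ?_
      rw [← Pi.add_apply, ← Matrix.mulVec_add]
      have := mulVec_apply_mono (i := i) (z := 0) (hnn l i) (w := (Q l (n + 1)).mulVec (fun _ => 1) +
        ∑ m ∈ Finset.range (n + 1), (Q l m).mulVec (fun _ => 1)) (fun j => by
          have := hQ.partialRowSum_nonpos (n + 1) l (by have := Finset.mem_range.1 hl; omega) j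
          rw [Finset.sum_range_succ] at this
          rw [Pi.add_apply, Finset.sum_apply, add_comm]
          exact this)
      simpa using this
    rw [h1] at h3
    simp only [Pi.neg_apply] at h3
    linarith
  have hpe : ∀ i j, pivot Q (n + 1) i j = -Q (n + 1) (n + 1) i j - (Q (n + 1) n * B) i j :=
    fun i j => by simp [pivot, pivotOf, hB]
  have hQB : ∀ i j, 0 ≤ (Q (n + 1) n * B) i j := fun i j => by
    rw [Matrix.mul_apply]
    exact Finset.sum_nonneg fun a _ => mul_nonneg (hQd i a) (hBnn a j)
  have hrow : ∀ i, -∑ l ∈ Finset.range (n + 1 + 1), (Q (n + 1) l).mulVec (fun _ => 1) i ≤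
      ∑ j, pivot Q (n + 1) i j := by
    intro i
    have h1 : ∑ l ∈ Finset.range (n + 1 + 1), (Q (n + 1) l).mulVec (fun _ => 1) i =
        (Q (n + 1) n).mulVec (fun _ => 1) i + (Q (n + 1) (n + 1)).mulVec (fun _ => 1) i := by
      rw [Finset.sum_range_succ, Finset.sum_range_succ, Finset.sum_eq_zero, zero_add]
      intro l hl
      have := Finset.mem_range.1 hl
      rw [hQ.eq_zero _ _ (by omega)]
      simp
    have h2 : ∑ j, (Q (n + 1) n * B) i j ≤ (Q (n + 1) n).mulVec (fun _ => 1) i := by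
      have : ∑ j, (Q (n + 1) n * B) i j =
          (Q (n + 1) n).mulVec (B.mulVec (fun _ => 1)) i := by
        rw [Matrix.mulVec_mulVec]
        simp [Matrix.mulVec, dotProduct]
      rw [this]
      exact mulVec_apply_mono (hQd i) hBe
    have h3 : (Q (n + 1) (n + 1)).mulVec (fun _ => 1) i = ∑ j, Q (n + 1) (n + 1) i j := by
      simp [Matrix.mulVec, dotProduct]
    simp only [hpe, Finset.sum_sub_distrib, Finset.sum_neg_distrib]
    linarith
  refine isUnit_and_inv_nonneg (fun i j hij => ?_) (fun i => ?_) (fun i => ?_)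
  · have := hQ.offDiag_nonneg (n + 1) i j hij
    have := hQB i j
    rw [hpe]
    linarith
  · have := hQ.partialRowSum_nonpos (n + 1) (n + 1) le_rfl i
    have := hrow i
    linarith
  · obtain ⟨j, hj, hlt⟩ := hQ.escape (n + 1) i
    have hsub : ∀ a b, a ≠ b ∧ 0 < Q (n + 1) (n + 1) a b → a ≠ b ∧ pivot Q (n + 1) a b < 0 := by
      rintro a b ⟨hab, hpos⟩
      have := hQB a b
      exact ⟨hab, by rw [hpe]; linarith⟩
    refine ⟨j, Relation.ReflTransGen.mono hsub _ _ hj, ?_⟩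
    have := hrow j
    linarith

theorem isUnit_pivot_zero : IsUnit (pivot Q 0) ∧ ∀ i j, 0 ≤ (pivot Q 0)⁻¹ i j := by
  have hrow : ∀ i, ∑ j, pivot Q 0 i j =
      -∑ l ∈ Finset.range (0 + 1), (Q 0 l).mulVec (fun _ => 1) i := fun i => by
    simp [pivot, Matrix.mulVec, dotProduct]
  refine isUnit_and_inv_nonneg (fun i j hij => ?_) (fun i => ?_) (fun i => ?_)
  · simpa [pivot] using hQ.offDiag_nonneg 0 i j hij
  · rw [hrow]
    exact neg_nonneg.2 (hQ.partialRowSum_nonpos 0 0 le_rfl i)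
  · obtain ⟨j, hj, hlt⟩ := hQ.escape 0 i
    refine ⟨j, 
      Relation.ReflTransGen.mono (fun a b hab => ⟨hab.1, by simpa [pivot] using hab.2⟩) _ _ hj, ?_⟩
    rw [hrow]
    exact neg_pos.2 hlt

theorem Ustar_spec (n : ℕ) : (IsUnit (pivot Q n) ∧ ∀ i j, 0 ≤ (pivot Q n)⁻¹ i j) ∧
    (∀ k i j, 0 ≤ Ustar Q n k i j) ∧
    ∀ l ≤ n, ∑ k ∈ Finset.range (n + 1), Ustar Q n k * Q k l = if l = n then -1 else 0 := by
  induction n with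
  | zero =>
    have hp := hQ.isUnit_pivot_zero
    refine ⟨hp, fun k i j => ?_, fun l hl => ?_⟩
    · rcases Nat.eq_zero_or_pos k with rfl | hk
      · rw [Ustar_self]
        exact hp.2 i j
      · rw [Ustar_of_lt Q hk]
        simp
    · obtain rfl : l = 0 := by omega
      have : Q 0 0 = -pivot Q 0 := by simp [pivot]
      rw [Finset.sum_range_one, Ustar_self, this, mul_neg,
        Matrix.nonsing_inv_mul _ ((Matrix.isUnit_iff_isUnit_det _).1 hp.1)]
      simp
  | succ n ih =>
    have hp := hQ.isUnit_pivot_succ ih.2.1 ih.2.2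
    refine ⟨hp, fun k i j => ?_, sum_Ustar_mul_succ hQ.eq_zero hp.1 ih.2.2⟩
    rcases lt_trichotomy k (n + 1) with hk | rfl | hk
    · rw [Ustar_succ_of_le Q (by omega), Matrix.mul_apply]
      refine Finset.sum_nonneg fun a _ => mul_nonneg ?_ (ih.2.1 k a j)
      rw [Matrix.mul_apply]
      exact Finset.sum_nonneg fun b _ =>
        mul_nonneg (hp.2 i b) (hQ.nonneg_of_ne _ _ (by omega) b a)
    · rw [Ustar_self]
      exact hp.2 i j
    · rw [Ustar_of_lt Q hk]
      simp

theorem Ustar_nonneg (n k : ℕ) (i j : ι) : 0 ≤ Ustar Q n k i j := (hQ.Ustar_spec n).2.1 k i j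

theorem sum_Ustar_mul {n l : ℕ} (hl : l ≤ n) :
    ∑ k ∈ Finset.range (n + 1), Ustar Q n k * Q k l = if l = n then -1 else 0 :=
  (hQ.Ustar_spec n).2.2 l hl

theorem sum_Ustar_mulVec (n : ℕ) (w : ℕ → ι → ℝ) :
    ∑ k ∈ Finset.range (n + 1),
      (Ustar Q n k).mulVec (∑ l ∈ Finset.range (n + 1), (Q k l).mulVec (w l)) = -w n :=
  sum_Ustar_mulVec_of_sum_mul (hQ.Ustar_spec n).2.2 w

omit hQ in
-- Makes `uStar` the row sums of the last block row, the constants that normalise `approx`.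
theorem uStar_eq_sum (n : ℕ) :
    uStar Q n = ∑ k ∈ Finset.range (n + 1), (Ustar Q n k).mulVec (fun _ => 1) := by
  induction n with
  | zero => simp [uStar]
  | succ n ih =>
    rw [Finset.sum_range_succ, uStar, Matrix.mulVec_add, ih, Matrix.mulVec_sum,
      Matrix.mulVec_sum, add_comm]
    congr 1
    refine Finset.sum_congr rfl fun k hk => ?_
    rw [Ustar_succ_of_le Q (Nat.lt_succ_iff.1 (Finset.mem_range.1 hk)), Ustar_self]
    simp only [Matrix.mulVec_mulVec, Matrix.mul_assoc]

theorem uStar_pos (n : ℕ) (i : ι) : 0 < uStar Q n i := by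
  rw [uStar_eq_sum, Finset.sum_range_succ, Pi.add_apply, Finset.sum_apply]
  refine add_pos_of_nonneg_of_pos (Finset.sum_nonneg fun k _ =>
    mulVec_apply_nonneg (hQ.Ustar_nonneg n k i) fun _ => zero_le_one) ?_
  have := inv_rowSum_pos (hQ.Ustar_spec n).1.1 (hQ.Ustar_spec n).1.2 i
  rw [Ustar_self]
  simpa [Matrix.mulVec, dotProduct] using this

theorem approx_nonneg (j : ℕ → ι) (n : ℕ) (x : ℕ × ι) : 0 ≤ approx Q j n x := by
  unfold approx
  split_ifs
  · exact div_nonneg (hQ.Ustar_nonneg _ _ _ _) (hQ.uStar_pos _ _).le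
  · exact le_rfl

omit hQ in
theorem approx_eq (j : ℕ → ι) (n : ℕ) (x : ℕ × ι) :
    approx Q j n x = Ustar Q n x.1 (j n) x.2 / uStar Q n (j n) := by
  unfold approx
  split_ifs with h
  · rfl
  · rw [Ustar_of_lt Q (not_le.1 h)]
    simp

omit hQ in
/-- Integrals of functions of the level against the approximation are finite sums. -/
theorem hasSum_approx_mul (j : ℕ → ι) (n : ℕ) (f : ℕ × ι → ℝ) :
    HasSum (fun x => approx Q j n x * f x)
      ((∑ k ∈ Finset.range (n + 1), (Ustar Q n k).mulVec (fun i => f (k, i)) (j n)) /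
        uStar Q n (j n)) := by
  have h : HasSum (fun x => approx Q j n x * f x)
      (∑ x ∈ Finset.range (n + 1) ×ˢ Finset.univ, approx Q j n x * f x) := by
    refine hasSum_sum_of_ne_finset_zero fun x hx => ?_
    have : ¬ x.1 ≤ n := by simpa [Nat.lt_succ_iff] using hx
    simp [approx, this]
  convert h using 1
  rw [Finset.sum_product, Finset.sum_div]
  refine Finset.sum_congr rfl fun k _ => ?_
  simp only [Matrix.mulVec, dotProduct, Finset.sum_div, approx_eq]
  exact Finset.sum_congr rfl fun i _ => by ring

theorem hasSum_approx (j : ℕ → ι) (n : ℕ) : HasSum (approx Q j n) 1 := by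
  have h := hasSum_approx_mul (Q := Q) j n (fun _ => 1)
  rw [← Finset.sum_apply, ← uStar_eq_sum, div_self (hQ.uStar_pos n _).ne'] at h
  simpa using h

/-- The approximation satisfies the balance equations below the truncation level. -/
theorem approx_balance (j : ℕ → ι) {n : ℕ} {y : ℕ × ι} (hy : y.1 < n) :
    HasSum (fun x => approx Q j n x * ofBlocks Q x y) 0 := by
  have h := hasSum_approx_mul (Q := Q) j n (fun x => ofBlocks Q x y)
  have h1 := congrFun (congrFun (hQ.sum_Ustar_mul hy.le) (j n)) y.2
  rw [if_neg hy.ne, Matrix.sum_apply] at h1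
  have h2 : ∑ k ∈ Finset.range (n + 1),
      (Ustar Q n k).mulVec (fun i => ofBlocks Q (k, i) y) (j n) = 0 := by
    simpa [Matrix.mul_apply, Matrix.mulVec, dotProduct, ofBlocks] using h1
  rwa [h2, zero_div] at h

/-- A Foster-Lyapunov inequality for a level function, valid for the last-column augmented
truncations, bounds its mean under every approximation. -/
theorem tsum_approx_mul_le {V : ℕ → ℝ} {θ b : ℝ} (hθ : 0 < θ)
    (hV : ∀ n k, k ≤ n → ∀ i,
      ∑ l ∈ Finset.range (n + 1), (Q k l).mulVec (fun _ => V l - V n) i ≤ -θ * V k + b)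
    (j : ℕ → ι) (n : ℕ) : ∑' x, approx Q j n x * V x.1 ≤ b / θ := by
  rw [(hasSum_approx_mul j n (fun x => V x.1)).tsum_eq, div_le_div_iff₀ (hQ.uStar_pos n _) hθ]
  -- Subtracting `V n` makes the test function vanish on level `n`, so the right side of the
  -- identity is zero.
  have h1 := congrFun (hQ.sum_Ustar_mulVec n (fun l _ => V l - V n)) (j n)
  rw [Finset.sum_apply] at h1
  have h2 : ∑ k ∈ Finset.range (n + 1), (Ustar Q n k).mulVec
      (∑ l ∈ Finset.range (n + 1), (Q k l).mulVec (fun _ => V l - V n)) (j n) ≤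
      ∑ k ∈ Finset.range (n + 1), (-θ * (Ustar Q n k).mulVec (fun _ => V k) (j n) +
        b * (Ustar Q n k).mulVec (fun _ => 1) (j n)) := by
    refine Finset.sum_le_sum fun k hk => ?_
    have h3 : -θ * (Ustar Q n k).mulVec (fun _ => V k) (j n) +
        b * (Ustar Q n k).mulVec (fun _ => 1) (j n) =
        (Ustar Q n k).mulVec (fun _ => -θ * V k + b) (j n) := by
      simp only [Matrix.mulVec, dotProduct, Finset.mul_sum, ← Finset.sum_add_distrib]
      exact Finset.sum_congr rfl fun i _ => by ring
    rw [h3]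
    refine mulVec_apply_mono (hQ.Ustar_nonneg n k _) fun i => ?_
    rw [Finset.sum_apply]
    exact hV n k (by simpa [Nat.lt_succ_iff] using hk) i
  rw [h1, Finset.sum_add_distrib, ← Finset.mul_sum, ← Finset.mul_sum] at h2
  rw [uStar_eq_sum, Finset.sum_apply]
  simp only [Pi.neg_apply, sub_self, neg_zero] at h2
  linarith

end IsHessenbergGenerator

end BlockAlgebra

/-! ### Increments of the logarithm and of `lyapV`. -/

section LogEstimates

theorem two_lt_exp_one : (2 : ℝ) < Real.exp 1 := by
  have := Real.exp_one_gt_d9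
  linarith

theorem one_le_log_add_exp_one {x : ℝ} (hx : 0 ≤ x) : 1 ≤ Real.log (x + Real.exp 1) := by
  rw [Real.le_log_iff_exp_le (by positivity)]
  linarith

theorem log_add_exp_one_mono {x y : ℝ} (hx : 0 ≤ x) (hxy : x ≤ y) :
    Real.log (x + Real.exp 1) ≤ Real.log (y + Real.exp 1) :=
  Real.log_le_log (by positivity) (by linarith)

theorem log_add_exp_one_le_lyapV {x : ℝ} (hx : 0 ≤ x) :
    Real.log (x + Real.exp 1) ≤ lyapV x := by
  have h1 := one_le_log_add_exp_one hx
  have h2 := two_lt_exp_one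
  exact le_mul_of_one_le_left (by linarith) (by linarith)

theorem one_le_lyapV {x : ℝ} (hx : 0 ≤ x) : 1 ≤ lyapV x :=
  (one_le_log_add_exp_one hx).trans (log_add_exp_one_le_lyapV hx)

theorem self_le_lyapV {x : ℝ} (hx : 0 ≤ x) : x ≤ lyapV x := by
  have h1 := one_le_log_add_exp_one hx
  have h2 := two_lt_exp_one
  have : x + Real.exp 1 ≤ lyapV x := le_mul_of_one_le_right (by linarith) h1
  linarith

theorem lyapV_mono {x y : ℝ} (hx : 0 ≤ x) (hxy : x ≤ y) : lyapV x ≤ lyapV y := by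
  have h1 := one_le_log_add_exp_one hx
  have h2 := two_lt_exp_one
  exact mul_le_mul (by linarith) (log_add_exp_one_mono hx hxy) (by linarith) (by linarith)

/-- Tangent line bound for the logarithm. -/
theorem log_add_sub_log_le {x m : ℝ} (hx : 0 ≤ x) (hm : 0 ≤ m) :
    Real.log (x + m + Real.exp 1) - Real.log (x + Real.exp 1) ≤ m / (x + Real.exp 1) := by
  have he := Real.exp_pos 1
  have hx' : 0 < x + Real.exp 1 := by linarith
  rw [← Real.log_div (by linarith) hx'.ne']
  refine (Real.log_le_sub_one_of_pos (by positivity)).trans (le_of_eq ?_)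
  field_simp
  ring

theorem log_add_le_log_add_log {x m : ℝ} (hx : 0 ≤ x) (hm : 0 ≤ m) :
    Real.log (x + m + Real.exp 1) ≤
      Real.log (x + Real.exp 1) + Real.log (m + Real.exp 1) := by
  have he := two_lt_exp_one
  rw [← Real.log_mul (by linarith) (by linarith)]
  refine Real.log_le_log (by linarith) ?_
  nlinarith [mul_nonneg hx hm]

/-- The increment is at most `m + m log (x + e) + m log (m + e)`, and each of the three terms is at
most `log (x + e) * lyapV m`. Only a logarithm of `x` appears, which linear departure rates can
beat. -/
theorem lyapV_add_sub_le {x m : ℝ} (hx : 0 ≤ x) (hm : 0 ≤ m) :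
    lyapV (x + m) - lyapV x ≤ 3 * Real.log (x + Real.exp 1) * lyapV m := by
  have he := two_lt_exp_one
  have hx' : 0 < x + Real.exp 1 := by linarith
  have h1 := log_add_sub_log_le hx hm
  rw [le_div_iff₀ hx'] at h1
  have h2 := mul_le_mul_of_nonneg_left (log_add_le_log_add_log hx hm) hm
  have h3 := one_le_log_add_exp_one hx
  have h4 := one_le_log_add_exp_one hm
  have h5 := self_le_lyapV hm
  have h6 : m * Real.log (m + Real.exp 1) ≤ lyapV m :=
    mul_le_mul_of_nonneg_right (by linarith) (by linarith)
  have h7 : lyapV m ≤ Real.log (x + Real.exp 1) * lyapV m :=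
    le_mul_of_one_le_left (by linarith) h3
  have h8 := mul_le_mul_of_nonneg_right h5 (zero_le_one.trans h3)
  simp only [lyapV] at *
  nlinarith

theorem log_le_lyapV_sub {x : ℝ} (hx : 0 ≤ x) :
    Real.log (x + 1 + Real.exp 1) ≤ lyapV (x + 1) - lyapV x := by
  have h1 := log_add_exp_one_mono hx (by linarith : x ≤ x + 1)
  have h2 := two_lt_exp_one
  have := mul_le_mul_of_nonneg_left h1 (by linarith : 0 ≤ x + Real.exp 1)
  simp only [lyapV]
  linarith

theorem inv_le_log_sub {x : ℝ} (hx : 0 ≤ x) :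
    1 / (x + 1 + Real.exp 1) ≤ Real.log (x + 1 + Real.exp 1) - Real.log (x + Real.exp 1) := by
  have he := Real.exp_pos 1
  have hx' : 0 < x + Real.exp 1 := by linarith
  have h1 := Real.log_le_sub_one_of_pos (x := (x + Real.exp 1) / (x + 1 + Real.exp 1))
    (by positivity)
  rw [Real.log_div hx'.ne' (by linarith)] at h1
  have h2 : (x + Real.exp 1) / (x + 1 + Real.exp 1) - 1 = -(1 / (x + 1 + Real.exp 1)) := by
    field_simp
    ring
  linarith

end LogEstimates

/-! ### Rows and irreducibility of the queue generator. -/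

section BMAPRows

variable {ι : Type*} [DecidableEq ι]

variable {D : ℕ → Matrix ι ι ℝ} {μ : ℝ}

theorem bmapBlocks_of_lt {k l : ℕ} (h : k < l) : bmapBlocks D μ k l = D (l - k) := by
  simp [bmapBlocks, h]

theorem bmapBlocks_self (k : ℕ) :
    bmapBlocks D μ k k = D 0 - ((k : ℝ) * μ) • (1 : Matrix ι ι ℝ) := by
  simp [bmapBlocks]

theorem bmapBlocks_succ (k : ℕ) :
    bmapBlocks D μ (k + 1) k = (((k + 1 : ℕ) : ℝ) * μ) • (1 : Matrix ι ι ℝ) := by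
  simp [bmapBlocks]

theorem bmapBlocks_of_succ_lt {k l : ℕ} (h : l + 1 < k) : bmapBlocks D μ k l = 0 := by
  have h1 : ¬ k < l := by omega
  have h2 : k ≠ l := by omega
  have h3 : k ≠ l + 1 := by omega
  simp [bmapBlocks, h1, h2, h3]

theorem bmapBlocks_self_of_ne (k : ℕ) {i j : ι} (h : i ≠ j) :
    bmapBlocks D μ k k i j = D 0 i j := by
  simp [bmapBlocks_self, h]

variable [Fintype ι]

omit [DecidableEq ι] in
theorem mulVec_const_apply (A : Matrix ι ι ℝ) (c : ℝ) (i : ι) :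
    A.mulVec (fun _ => c) i = A.mulVec (fun _ => 1) i * c := by
  simp [Matrix.mulVec, dotProduct, Finset.sum_mul]

theorem bmapBlocks_nonneg_of_ne (hD : IsBMAP D) (hμ : 0 < μ) {k l : ℕ} (hkl : k ≠ l) (i j : ι) :
    0 ≤ bmapBlocks D μ k l i j := by
  rcases lt_or_gt_of_ne hkl with h | h
  · rw [bmapBlocks_of_lt h]
    exact hD.nonneg _ (by omega) i j
  · rcases Nat.lt_or_ge (l + 1) k with h' | h'
    · rw [bmapBlocks_of_succ_lt h']
      simp
    · obtain rfl : k = l + 1 := by omega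
      rw [bmapBlocks_succ, Matrix.smul_apply, smul_eq_mul, Matrix.one_apply]
      split_ifs <;> positivity

/-- The truncated `k - 1` is harmless at `k = 0`, where its factor `k` vanishes. -/
theorem sum_range_bmapBlocks (f : ℕ → ℝ) (k : ℕ) (i : ι) :
    ∑ l ∈ Finset.range (k + 1), (bmapBlocks D μ k l).mulVec (fun _ => f l) i =
      k * μ * (f (k - 1) - f k) + (D 0).mulVec (fun _ => 1) i * f k := by
  have hself : (bmapBlocks D μ k k).mulVec (fun _ => f k) i =
      (D 0).mulVec (fun _ => 1) i * f k - k * μ * f k := by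
    rw [bmapBlocks_self, Matrix.sub_mulVec, Matrix.smul_mulVec, Matrix.one_mulVec,
      Pi.sub_apply, mulVec_const_apply]
    simp
  rw [Finset.sum_range_succ, hself]
  cases k with
  | zero => simp
  | succ k =>
    rw [Finset.sum_range_succ, Finset.sum_eq_zero, bmapBlocks_succ, Matrix.smul_mulVec,
      Matrix.one_mulVec]
    · simp
      ring
    · intro l hl
      rw [bmapBlocks_of_succ_lt (by simpa using hl)]
      simp

namespace IsBMAP

variable (hD : IsBMAP D)
include hD

omit [DecidableEq ι] in
theorem rowSum_nonneg (m : ℕ) (i : ι) : 0 ≤ (D (m + 1)).mulVec (fun _ => 1) i :=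
  mulVec_apply_nonneg (hD.nonneg _ (by omega) i) fun _ => zero_le_one

omit [DecidableEq ι] in
theorem apply_le_rowSum (m : ℕ) (i j : ι) :
    D (m + 1) i j ≤ (D (m + 1)).mulVec (fun _ => 1) i := by
  simp only [Matrix.mulVec, dotProduct, mul_one]
  exact Finset.single_le_sum (fun a _ => hD.nonneg _ (by omega) i a) (Finset.mem_univ j)

omit [DecidableEq ι] in
theorem hasSum_rowSum (i : ι) : HasSum (fun m => (D m).mulVec (fun _ => 1) i) 0 := by
  have h := hasSum_sum (s := Finset.univ) fun j _ => (hD.summable i j).hasSum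
  rw [hD.conservative i] at h
  simpa [Matrix.mulVec, dotProduct] using h

omit [DecidableEq ι] in
theorem hasSum_rowSum_succ (i : ι) :
    HasSum (fun m => (D (m + 1)).mulVec (fun _ => 1) i) (-(D 0).mulVec (fun _ => 1) i) := by
  have h := (hasSum_nat_add_iff' 1).2 (hD.hasSum_rowSum i)
  simpa using h

/-- Action of the generator on a function of the level. -/
theorem hasSum_row {f : ℕ → ℝ} {k : ℕ} {i : ι}
    (hf : Summable fun m => (D (m + 1)).mulVec (fun _ => 1) i * f (k + (m + 1))) :
    HasSum (fun l => (bmapBlocks D μ k l).mulVec (fun _ => f l) i)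
      (k * μ * (f (k - 1) - f k) +
        ∑' m, (D (m + 1)).mulVec (fun _ => 1) i * (f (k + (m + 1)) - f k)) := by
  rw [← hasSum_nat_add_iff' (k + 1), sum_range_bmapBlocks]
  have h1 : (fun m => (bmapBlocks D μ k (m + (k + 1))).mulVec (fun _ => f (m + (k + 1))) i) =
      fun m => (D (m + 1)).mulVec (fun _ => 1) i * f (k + (m + 1)) := by
    funext m
    rw [mulVec_const_apply, bmapBlocks_of_lt (by omega),
      show m + (k + 1) - k = m + 1 by omega, show m + (k + 1) = k + (m + 1) by omega]
  rw [h1]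
  -- Conservativity turns the `D 0` term into subtraction of `f k` inside the batch sum.
  have h2 := (hD.hasSum_rowSum_succ i).mul_right (f k)
  have h3 : ∑' m, (D (m + 1)).mulVec (fun _ => 1) i * (f (k + (m + 1)) - f k) =
      ∑' m, (D (m + 1)).mulVec (fun _ => 1) i * f (k + (m + 1)) -
        (-(D 0).mulVec (fun _ => 1) i * f k) := by
    simp only [mul_sub]
    exact (hf.hasSum.sub h2).tsum_eq
  rw [h3]
  refine Eq.subst (motive := fun s => HasSum _ s) ?_ hf.hasSum
  ring

/-- Action of the generator on a nonnegative function of the level, in terms of states. -/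
theorem hasSum_ofBlocks_row {f : ℕ → ℝ} {k : ℕ} {i : ι} (hf0 : ∀ l, 0 ≤ f l)
    (hf : Summable fun m => (D (m + 1)).mulVec (fun _ => 1) i * f (k + (m + 1))) :
    HasSum (fun y => ofBlocks (bmapBlocks D μ) (k, i) y * f y.1)
      (k * μ * (f (k - 1) - f k) +
        ∑' m, (D (m + 1)).mulVec (fun _ => 1) i * (f (k + (m + 1)) - f k)) := by
  have hj : ∀ j, Summable fun l => bmapBlocks D μ k l i j * f l := by
    intro j
    rw [← summable_nat_add_iff (k + 1)]
    refine Summable.of_nonneg_of_le (fun m => ?_) (fun m => ?_) hf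
    · rw [bmapBlocks_of_lt (by omega)]
      exact mul_nonneg (hD.nonneg _ (by omega) i j) (hf0 _)
    · rw [bmapBlocks_of_lt (by omega), show m + (k + 1) - k = m + 1 by omega,
        show m + (k + 1) = k + (m + 1) by omega]
      exact mul_le_mul_of_nonneg_right (hD.apply_le_rowSum m i j) (hf0 _)
  have h := hasSum_prod_of_phases (g := fun y => ofBlocks (bmapBlocks D μ) (k, i) y * f y.1)
    fun j => (hj j).hasSum
  convert h using 1
  rw [← Summable.tsum_finsetSum fun j _ => hj j, ← (hD.hasSum_row hf).tsum_eq]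
  simp [Matrix.mulVec, dotProduct]

theorem hasSum_ofBlocks (x : ℕ × ι) : HasSum (ofBlocks (bmapBlocks D μ) x) 0 := by
  have h := hD.hasSum_ofBlocks_row (μ := μ) (f := fun _ => 1) (k := x.1) (i := x.2)
    (fun _ => zero_le_one) (by simpa using (hD.hasSum_rowSum_succ x.2).summable)
  simpa using h

theorem ofBlocks_offDiag_nonneg (hμ : 0 < μ) {x y : ℕ × ι} (hxy : x ≠ y) :
    0 ≤ ofBlocks (bmapBlocks D μ) x y := by
  obtain ⟨k, i⟩ := x
  obtain ⟨l, j⟩ := y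
  simp only [ofBlocks]
  by_cases hkl : k = l
  · subst hkl
    have hij : i ≠ j := fun h => hxy (by rw [h])
    rw [bmapBlocks_self_of_ne _ hij]
    exact hD.offDiag_nonneg i j hij
  · exact bmapBlocks_nonneg_of_ne hD hμ hkl i j

omit [DecidableEq ι] in
theorem exists_pos_arrival : ∃ m i j, 0 < D (m + 1) i j := by
  obtain ⟨k, hk, hne⟩ := hD.arrivals
  obtain ⟨m, rfl⟩ : ∃ m, k = m + 1 := ⟨k - 1, by omega⟩
  by_contra! h
  exact hne (by ext i j; exact le_antisymm (h m i j) (hD.nonneg _ hk i j))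

omit [DecidableEq ι] in
theorem rowSum_zero_neg {m : ℕ} {i j : ι} (h : 0 < D (m + 1) i j) :
    (D 0).mulVec (fun _ => 1) i < 0 := by
  have h1 := le_hasSum (hD.hasSum_rowSum_succ i) m fun b _ => hD.rowSum_nonneg b i
  have h2 := hD.apply_le_rowSum m i j
  linarith

omit [DecidableEq ι] in
/-- Transitions without arrivals lead from every phase to one in which arrivals occur. -/
theorem exists_reach_rowSum_neg (i : ι) :
    ∃ j, Relation.ReflTransGen (fun a b => a ≠ b ∧ 0 < D 0 a b) i j ∧
      (D 0).mulVec (fun _ => 1) j < 0 := by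
  obtain ⟨m, i₀, j₀, hpos⟩ := hD.exists_pos_arrival
  have hpath := hD.irreducible i i₀
  induction hpath using Relation.ReflTransGen.head_induction_on with
  | refl => exact ⟨i₀, .refl, hD.rowSum_zero_neg hpos⟩
  -- If no arrivals occur in phase `a`, every `D (m + 1) a b` is zero, so the positive rate from `a`
  -- to `b` comes from `D 0`.
  | @head a b hab _ ih =>
    by_cases ha : (D 0).mulVec (fun _ => 1) a < 0
    · exact ⟨a, .refl, ha⟩
    · obtain ⟨j, hj, hlt⟩ := ih
      refine ⟨j, .head ⟨hab.1, ?_⟩ hj, hlt⟩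
      have h0 : ∀ m, D (m + 1) a b = 0 := fun m =>
        le_antisymm (not_lt.1 fun h => ha (hD.rowSum_zero_neg h)) (hD.nonneg _ (by omega) a b)
      have h1 : 0 < ∑' k, D k a b := hab.2
      rwa [(hD.summable a b).tsum_eq_zero_add, tsum_congr h0, tsum_zero, add_zero] at h1

theorem isHessenbergGenerator (hμ : 0 < μ) : IsHessenbergGenerator (bmapBlocks D μ) where
  eq_zero _ _ h := bmapBlocks_of_succ_lt h
  nonneg_of_ne _ _ h := bmapBlocks_nonneg_of_ne hD hμ h
  offDiag_nonneg k i j h := by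
    rw [bmapBlocks_self_of_ne _ h]
    exact hD.offDiag_nonneg i j h
  partialRowSum_nonpos n k hk i := by
    have h := hD.hasSum_row (μ := μ) (f := fun _ => 1) (k := k) (i := i)
      (by simpa using (hD.hasSum_rowSum_succ i).summable)
    simp only [sub_self, mul_zero, tsum_zero, add_zero] at h
    refine sum_le_hasSum _ (fun l hl => ?_) h
    have hne : k ≠ l := by
      have : ¬ l < n + 1 := by simpa using hl
      omega
    exact mulVec_apply_nonneg (bmapBlocks_nonneg_of_ne hD hμ hne i) fun _ => zero_le_one
  escape n i := by
    obtain ⟨j, hj, hlt⟩ := hD.exists_reach_rowSum_neg i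
    refine ⟨j, Relation.ReflTransGen.mono (fun a b hab => ⟨hab.1, ?_⟩) _ _ hj, ?_⟩
    · rw [sum_range_bmapBlocks (fun _ => 1)]
      simpa using hlt
    · rw [bmapBlocks_self_of_ne _ hab.1]
      exact hab.2

/-- Phase changes along `∑ D k` never lower the level, and repeated visits to a phase with arrivals
raise it arbitrarily. From high enough, reach the target phase, then descend by departures, which
keep the phase. -/
theorem isIrreducibleGenerator (hμ : 0 < μ) :
    IsIrreducibleGenerator (ofBlocks (bmapBlocks D μ)) := by
  set R := Relation.ReflTransGen (fun a b : ℕ × ι => a ≠ b ∧ 0 < ofBlocks (bmapBlocks D μ) a b)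
    with hR
  have down : ∀ (d l : ℕ) (i : ι), R (l + d, i) (l, i) := by
    intro d l i
    induction d with
    | zero => exact .refl
    | succ d ih =>
      refine .head ⟨fun h => ?_, ?_⟩ ih
      · have := congrArg Prod.fst h
        simp at this
      · simp only [ofBlocks]
        rw [← add_assoc, bmapBlocks_succ, Matrix.smul_apply, Matrix.one_apply_eq, smul_eq_mul,
          mul_one]
        positivity
  have arr : ∀ (m k : ℕ) (i j : ι), (k, i) ≠ (k + m, j) → 0 < D m i j → R (k, i) (k + m, j) := by
    intro m k i j hne hpos
    refine .single ⟨hne, ?_⟩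
    simp only [ofBlocks]
    cases m with
    | zero =>
      have hij : i ≠ j := fun h => hne (by simp [h])
      rw [add_zero, bmapBlocks_self_of_ne _ hij]
      exact hpos
    | succ m =>
      rw [bmapBlocks_of_lt (by omega), Nat.add_sub_cancel_left]
      exact hpos
  have phase : ∀ (i j : ι) (k : ℕ), ∃ l, k ≤ l ∧ R (k, i) (l, j) := by
    intro i j
    have hpath := hD.irreducible i j
    induction hpath with
    | refl => exact fun k => ⟨k, le_rfl, .refl⟩
    | @tail b c _ hbc ih =>
      intro k
      obtain ⟨l, hkl, hl⟩ := ih k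
      obtain ⟨m, hm⟩ : ∃ m, 0 < D m b c := by
        by_contra! h
        exact absurd hbc.2 (not_lt.2 (tsum_nonpos h))
      exact ⟨l + m, by omega, hl.trans (arr m l b c (fun h => hbc.1 (congrArg Prod.snd h)) hm)⟩
  obtain ⟨m, i₀, j₀, hpos⟩ := hD.exists_pos_arrival
  have up : ∀ (l : ℕ) (x : ℕ × ι), ∃ k, l ≤ k ∧ R x (k, i₀) := by
    intro l x
    induction l with
    | zero =>
      obtain ⟨k, -, hk⟩ := phase x.2 i₀ x.1
      exact ⟨k, Nat.zero_le _, hk⟩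
    | succ l ih =>
      obtain ⟨k, hlk, hk⟩ := ih
      obtain ⟨k', hk', hk''⟩ := phase j₀ i₀ (k + (m + 1))
      refine ⟨k', by omega, (hk.trans (arr _ _ _ _ (fun h => ?_) hpos)).trans hk''⟩
      have := congrArg Prod.fst h
      simp at this
  intro x y
  obtain ⟨k, hk, hxk⟩ := up y.1 x
  obtain ⟨l, hl, hkl⟩ := phase i₀ y.2 k
  have h := down (l - y.1) y.1 y.2
  rw [show y.1 + (l - y.1) = l by omega] at h
  exact (hxk.trans hkl).trans h

end IsBMAP

end BMAPRows

/-! ### Drift inequalities from the batch moment. -/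

section BMAPDrift

variable {ι : Type*} [Fintype ι]

/-- The weighted batch sizes of all phases have mean less than `C`. -/
structure HasBatchMoment (D : ℕ → Matrix ι ι ℝ) (C : ℝ) : Prop where
  summable : ∀ i, Summable fun k : ℕ => lyapV ((k + 1 : ℕ) : ℝ) * (D (k + 1)).mulVec (fun _ => 1) i
  lt : ∀ i, ∑' k : ℕ, lyapV ((k + 1 : ℕ) : ℝ) * (D (k + 1)).mulVec (fun _ => 1) i < C

variable {D : ℕ → Matrix ι ι ℝ} {μ C : ℝ}

namespace HasBatchMoment

variable (hC : HasBatchMoment D C) (hD : IsBMAP D)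
include hC hD

/-- The moment hypothesis enters the estimates only through this comparison. -/
theorem summable_and_tsum_le (i : ι) {g : ℕ → ℝ} {a : ℝ} (ha : 0 ≤ a) (h0 : ∀ m, 0 ≤ g m)
    (h : ∀ m : ℕ, g m ≤ a * lyapV ((m + 1 : ℕ) : ℝ)) :
    Summable (fun m => (D (m + 1)).mulVec (fun _ => 1) i * g m) ∧
      ∑' m, (D (m + 1)).mulVec (fun _ => 1) i * g m ≤ a * C := by
  have hs := (hC.summable i).mul_left a
  have hle : ∀ m, (D (m + 1)).mulVec (fun _ => 1) i * g m ≤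
      a * (lyapV ((m + 1 : ℕ) : ℝ) * (D (m + 1)).mulVec (fun _ => 1) i) := fun m => by
    have := mul_le_mul_of_nonneg_left (h m) (hD.rowSum_nonneg m i)
    linarith
  have hs' := Summable.of_nonneg_of_le (fun m => mul_nonneg (hD.rowSum_nonneg m i) (h0 m)) hle hs
  refine ⟨hs', (hs'.tsum_le_tsum hle hs).trans ?_⟩
  rw [tsum_mul_left]
  exact mul_le_mul_of_nonneg_left (hC.lt i).le ha

theorem summable_of_le_lyapV (i : ι) (k : ℕ) {f : ℕ → ℝ} {c : ℝ} (hc : 0 ≤ c)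
    (hf0 : ∀ l, 0 ≤ f l) (hf : ∀ l : ℕ, f l ≤ c * lyapV l) :
    Summable fun m => (D (m + 1)).mulVec (fun _ => 1) i * f (k + (m + 1)) := by
  have hk : (0 : ℝ) ≤ k := k.cast_nonneg
  have hV := one_le_lyapV hk
  have hL := one_le_log_add_exp_one hk
  refine (hC.summable_and_tsum_le hD i (g := fun m => f (k + (m + 1)))
    (a := c * (lyapV k + 3 * Real.log (k + Real.exp 1))) (by positivity)
    (fun m => hf0 _) fun m => (hf _).trans ?_).1
  have hm : (0 : ℝ) ≤ ((m + 1 : ℕ) : ℝ) := Nat.cast_nonneg _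
  have h1 := lyapV_add_sub_le hk hm
  have h2 := le_mul_of_one_le_right (zero_le_one.trans hV) (one_le_lyapV hm)
  rw [mul_assoc, Nat.cast_add k]
  refine mul_le_mul_of_nonneg_left ?_ hc
  linarith

variable [DecidableEq ι]

/-- The function `lyapV`, shifted by a constant, on the levels. -/
theorem hasSum_lyapV_sub (k : ℕ) (a : ℝ) (i : ι) :
    HasSum (fun l : ℕ => (bmapBlocks D μ k l).mulVec (fun _ => lyapV l - a) i)
      (k * μ * (lyapV ((k - 1 : ℕ) : ℝ) - lyapV k) +
        ∑' m : ℕ, (D (m + 1)).mulVec (fun _ => 1) i *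
          (lyapV ((k + (m + 1) : ℕ) : ℝ) - lyapV k)) := by
  have hs := hC.summable_of_le_lyapV hD i k (f := fun l => lyapV l) zero_le_one
    (fun l => zero_le_one.trans (one_le_lyapV l.cast_nonneg)) fun l => (one_mul _).ge
  have h := hD.hasSum_row (μ := μ) (f := fun l => lyapV l - a) (k := k) (i := i) (by
    simp only [mul_sub]
    exact hs.sub ((hD.hasSum_rowSum_succ i).mul_right a).summable)
  simpa only [sub_sub_sub_cancel_right] using h

omit [DecidableEq ι] in
theorem lyapV_drift_le (hμ : 0 < μ) (k : ℕ) (i : ι) :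
    k * μ * (lyapV ((k - 1 : ℕ) : ℝ) - lyapV k) +
        ∑' m : ℕ, (D (m + 1)).mulVec (fun _ => 1) i *
          (lyapV ((k + (m + 1) : ℕ) : ℝ) - lyapV k) ≤
      (3 * C - k * μ) * Real.log (k + Real.exp 1) := by
  have hk : (0 : ℝ) ≤ k := k.cast_nonneg
  have hL := one_le_log_add_exp_one hk
  have h1 := (hC.summable_and_tsum_le hD i
    (g := fun m => lyapV ((k + (m + 1) : ℕ) : ℝ) - lyapV k)
    (a := 3 * Real.log (k + Real.exp 1)) (by positivity)
    (fun m => sub_nonneg.2 (lyapV_mono hk (by exact_mod_cast Nat.le_add_right _ _)))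
    (fun m => by rw [Nat.cast_add k]; exact lyapV_add_sub_le hk (Nat.cast_nonneg _))).2
  have h2 : k * μ * (lyapV ((k - 1 : ℕ) : ℝ) - lyapV k) ≤
      -(k * μ) * Real.log (k + Real.exp 1) := by
    cases k with
    | zero => simp
    | succ k =>
      have h3 := log_le_lyapV_sub (x := k) k.cast_nonneg
      have h4 : 0 ≤ ((k + 1 : ℕ) : ℝ) * μ := by positivity
      have h5 := mul_le_mul_of_nonneg_left h3 h4
      rw [Nat.add_sub_cancel, Nat.cast_succ] at *
      linarith
  linarith

theorem exists_lyapV_drift (hμ : 0 < μ) (hC0 : 0 < C) :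
    ∃ K : ℕ, ∃ θ : ℝ, 0 < θ ∧ ∀ k : ℕ, K + 1 ≤ k → ∀ i : ι,
      Summable (fun l : ℕ => (bmapBlocks D μ k l).mulVec (fun _ => lyapV l) i) ∧
      ∑' l : ℕ, (bmapBlocks D μ k l).mulVec (fun _ => lyapV l) i ≤ -θ * lyapV k ∧
      -θ * lyapV k ≤ -1 := by
  -- Since `e < 3`, `(k - 3)μ ≥ 6C` gives `3C - kμ ≤ -(μ/2)(k + e)`; the extra `2` gives `(μ/2)(k +
  -- e) ≥ 1`.
  obtain ⟨K, hK⟩ := exists_nat_ge ((6 * C + 2) / μ + 3)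
  refine ⟨K, μ / 2, by positivity, fun k hk i => ?_⟩
  have h := hC.hasSum_lyapV_sub (μ := μ) hD k 0 i
  simp only [sub_zero] at h
  have hk0 : (0 : ℝ) ≤ k := k.cast_nonneg
  have hL := one_le_log_add_exp_one hk0
  have he := Real.exp_one_lt_d9
  have he' := Real.exp_pos 1
  have hkK : (6 * C + 2) / μ + 3 ≤ k := hK.trans (by exact_mod_cast (by omega : K ≤ k))
  have hkμ : 6 * C + 2 ≤ (k - 3) * μ := (div_le_iff₀ hμ).1 (by linarith)
  refine ⟨h.summable, ?_, ?_⟩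
  · rw [h.tsum_eq]
    refine (hC.lyapV_drift_le hD hμ k i).trans ?_
    rw [lyapV, ← mul_assoc]
    refine mul_le_mul_of_nonneg_right ?_ (by linarith)
    nlinarith
  · have h1 : (k : ℝ) + Real.exp 1 ≤ lyapV k := le_mul_of_one_le_right (by linarith) hL
    have h2 := mul_le_mul_of_nonneg_left h1 hμ.le
    nlinarith

/-- A drift inequality for the last-column augmented truncations. -/
theorem exists_truncated_drift (hμ : 0 < μ) (hC0 : 0 < C) :
    ∃ b : ℝ, ∀ n k : ℕ, k ≤ n → ∀ i : ι,
      ∑ l ∈ Finset.range (n + 1), (bmapBlocks D μ k l).mulVec (fun _ => lyapV l - lyapV n) i ≤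
        -(μ / 2) * lyapV k + b := by
  -- Beyond `K` the coefficient `3C + 2μ - kμ/2` is nonpositive; the `2μ` absorbs `μe/2`.
  obtain ⟨K, hK⟩ := exists_nat_ge (6 * C / μ + 4)
  have hKL := one_le_log_add_exp_one (x := K) K.cast_nonneg
  refine ⟨(3 * C + 2 * μ) * Real.log (K + Real.exp 1), fun n k hk i => ?_⟩
  have h := hC.hasSum_lyapV_sub (μ := μ) hD k (lyapV n) i
  -- The omitted terms have `l > n`, hence `lyapV l ≥ lyapV n` and nonnegative blocks: truncation
  -- only lowers the sum.
  refine (sum_le_hasSum _ (fun l hl => ?_) h).trans ((hC.lyapV_drift_le hD hμ k i).trans ?_)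
  · have hl' : n < l := by simpa [Nat.lt_succ_iff] using hl
    rw [bmapBlocks_of_lt (hk.trans_lt hl')]
    refine mulVec_apply_nonneg (hD.nonneg _ (by omega) i) fun _ => sub_nonneg.2 ?_
    exact lyapV_mono n.cast_nonneg (by exact_mod_cast hl'.le)
  · have hk0 : (0 : ℝ) ≤ k := k.cast_nonneg
    have hL := one_le_log_add_exp_one hk0
    have he := Real.exp_one_lt_d9
    have he' := Real.exp_pos 1
    rw [lyapV]
    have key : (3 * C + 2 * μ - k * μ / 2) * Real.log (k + Real.exp 1) ≤
        (3 * C + 2 * μ) * Real.log (K + Real.exp 1) := by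
      rcases le_total k K with hkK | hkK
      · have h1 := log_add_exp_one_mono hk0 (by exact_mod_cast hkK : (k : ℝ) ≤ K)
        have h2 := mul_le_mul_of_nonneg_left h1 (by positivity : 0 ≤ 3 * C + 2 * μ)
        have h3 : 0 ≤ k * μ / 2 * Real.log (k + Real.exp 1) := by positivity
        linarith
      · have h1 : 6 * C / μ + 4 ≤ k := hK.trans (by exact_mod_cast hkK)
        have h2 : 6 * C ≤ (k - 4) * μ := (div_le_iff₀ hμ).1 (by linarith)
        have h3 : (3 * C + 2 * μ - k * μ / 2) * Real.log (k + Real.exp 1) ≤ 0 :=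
          mul_nonpos_of_nonpos_of_nonneg (by linarith) (by linarith)
        exact h3.trans (by positivity)
    have h4 := mul_le_mul_of_nonneg_right
      (mul_le_mul_of_nonneg_left (by linarith : Real.exp 1 / 2 ≤ 2) hμ.le) (zero_le_one.trans hL)
    linarith

omit [DecidableEq ι] in
-- A departure lowers the function by at least `c / (k + e)` and has rate `kμ`, giving nearly `-cμ`;
-- arrivals cost at most `cC / (k + e)`. The `3` majorises `e`.
theorem log_drift_le (hμ : 0 < μ) {c : ℝ} (hc : 0 < c) (k : ℕ) (i : ι) :
    k * μ * (c * Real.log (((k - 1 : ℕ) : ℝ) + Real.exp 1) - c * Real.log (k + Real.exp 1)) +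
        ∑' m : ℕ, (D (m + 1)).mulVec (fun _ => 1) i *
          (c * Real.log (((k + (m + 1) : ℕ) : ℝ) + Real.exp 1) -
            c * Real.log (k + Real.exp 1)) ≤
      -(c * μ) + c * (3 * μ + C) / (k + Real.exp 1) := by
  have hk : (0 : ℝ) ≤ k := k.cast_nonneg
  have he := Real.exp_one_lt_d9
  have he' := Real.exp_pos 1
  have hx : 0 < (k : ℝ) + Real.exp 1 := by linarith
  have h1 := (hC.summable_and_tsum_le hD i
    (g := fun m => c * Real.log (((k + (m + 1) : ℕ) : ℝ) + Real.exp 1) -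
            c * Real.log (k + Real.exp 1))
    (a := c / (k + Real.exp 1)) (by positivity)
    (fun m => sub_nonneg.2 (mul_le_mul_of_nonneg_left
      (log_add_exp_one_mono hk (by exact_mod_cast Nat.le_add_right _ _)) hc.le))
    (fun m => by
      have hm : (0 : ℝ) ≤ ((m + 1 : ℕ) : ℝ) := Nat.cast_nonneg _
      have h2 := (log_add_sub_log_le hk hm).trans
        (div_le_div_of_nonneg_right (self_le_lyapV hm) hx.le)
      have h3 := mul_le_mul_of_nonneg_left h2 hc.le
      rw [Nat.cast_add k, ← mul_sub, div_mul_eq_mul_div, mul_div_assoc]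
      exact h3)).2
  have h2 : k * μ * (c * Real.log (((k - 1 : ℕ) : ℝ) + Real.exp 1) -
      c * Real.log (k + Real.exp 1)) ≤ -(c * μ) * (k / (k + Real.exp 1)) := by
    cases k with
    | zero => simp
    | succ k =>
      have h3 := inv_le_log_sub (x := k) k.cast_nonneg
      have h4 : 0 ≤ ((k + 1 : ℕ) : ℝ) * μ * c := by positivity
      have h5 := mul_le_mul_of_nonneg_left h3 h4
      rw [Nat.add_sub_cancel, Nat.cast_succ] at *
      have h6 : (k + 1) * μ * c * (1 / (k + 1 + Real.exp 1)) =
          c * μ * ((k + 1) / (k + 1 + Real.exp 1)) := by ring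
      linarith
  have h3 : -(c * μ) * (k / (k + Real.exp 1)) + c / (k + Real.exp 1) * C ≤
      -(c * μ) + c * (3 * μ + C) / (k + Real.exp 1) := by
    have h4 : -(c * μ) * (k / (k + Real.exp 1)) + c / (k + Real.exp 1) * C =
        -(c * μ) + c * (Real.exp 1 * μ + C) / (k + Real.exp 1) := by
      field_simp
      ring
    rw [h4]
    gcongr
    linarith
  linarith

theorem driftCondition (hμ : 0 < μ) (hC0 : 0 < C) {c : ℝ} (hc : 1 < c * μ) :
    DriftCondition (ofBlocks (bmapBlocks D μ)) (logVec c) := by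
  have hc0 : 0 < c := pos_of_mul_pos_left (zero_lt_one.trans hc) hμ.le
  set f : ℕ → ℝ := fun l => c * Real.log ((l : ℝ) + Real.exp 1) with hf
  have hf0 : ∀ l, c ≤ f l := fun l =>
    le_mul_of_one_le_right hc0.le (one_le_log_add_exp_one l.cast_nonneg)
  have hrow : ∀ k i, HasSum (fun y => ofBlocks (bmapBlocks D μ) (k, i) y * logVec c y) _ :=
    fun k i => hD.hasSum_ofBlocks_row (μ := μ) (f := f) (k := k) (i := i)
      (fun l => hc0.le.trans (hf0 l))
      (hC.summable_of_le_lyapV hD i k hc0.le (fun l => hc0.le.trans (hf0 l)) fun l =>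
        mul_le_mul_of_nonneg_left (log_add_exp_one_le_lyapV l.cast_nonneg) hc0.le)
  -- Past `K` the error in `log_drift_le` is at most `c * μ - 1`, positive by hypothesis; the levels
  -- up to `K` form the exceptional set.
  obtain ⟨K, hK⟩ := exists_nat_ge (c * (3 * μ + C) / (c * μ - 1))
  refine ⟨hD.isIrreducibleGenerator hμ, ⟨c, hc0, fun x => hf0 x.1⟩,
    fun x => (hrow x.1 x.2).summable, c * (3 * μ + C), by positivity,
    Finset.range (K + 1) ×ˢ Finset.univ, fun x => ?_⟩
  rw [(hrow x.1 x.2).tsum_eq]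
  refine (hC.log_drift_le hD hμ hc0 x.1 x.2).trans ?_
  have hx : (0 : ℝ) ≤ (x.1 : ℝ) := Nat.cast_nonneg _
  have he := two_lt_exp_one
  by_cases hxK : x.1 ≤ K
  · rw [Set.indicator_of_mem (by simp; omega), mul_one]
    have : c * (3 * μ + C) / (x.1 + Real.exp 1) ≤ c * (3 * μ + C) :=
      div_le_self (by positivity) (by linarith)
    linarith
  · rw [Set.indicator_of_notMem (by simp; omega), mul_zero, add_zero]
    have h1 : c * (3 * μ + C) / (c * μ - 1) ≤ x.1 + Real.exp 1 := by
      have : (K : ℝ) ≤ x.1 := by exact_mod_cast (by omega : K ≤ x.1)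
      linarith
    rw [div_le_iff₀ (by linarith)] at h1
    have h2 : c * (3 * μ + C) / (x.1 + Real.exp 1) ≤ c * μ - 1 :=
      (div_le_iff₀ (by linarith)).2 (by linarith)
    linarith

end HasBatchMoment

end BMAPDrift

/-! ### Tightness, stationary limits and total variation. -/

section Limit

section TotalVariation

variable {S : Type*}

/-- Scheffé's lemma for probability vectors. -/
theorem tendsto_tvDist_of_pointwise {a : ℕ → S → ℝ} {p : S → ℝ} (ha0 : ∀ n x, 0 ≤ a n x)
    (ha : ∀ n, HasSum (a n) 1) (hp0 : ∀ x, 0 ≤ p x) (hp : HasSum p 1)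
    (hlim : ∀ x, Tendsto (fun n => a n x) atTop (𝓝 (p x))) :
    Tendsto (fun n => tvDist (a n) p) atTop (𝓝 0) := by
  have hdom : ∀ n x, ‖max (p x - a n x) 0‖ ≤ p x := fun n x => by
    rw [Real.norm_of_nonneg (le_max_right _ _)]
    exact max_le (by linarith [ha0 n x]) (hp0 x)
  have h1 : Tendsto (fun n => ∑' x, max (p x - a n x) 0) atTop (𝓝 (∑' _ : S, 0)) := by
    refine tendsto_tsum_of_dominated_convergence hp.summable (fun x => ?_)
      (.of_forall fun n x => hdom n x)
    have := ((tendsto_const_nhds (x := p x)).sub (hlim x)).max (tendsto_const_nhds (x := (0 : ℝ)))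
    simpa using this
  -- Termwise `|a - p| = 2 (p - a)⁺ + (a - p)`, and the last part sums to zero.
  have h2 : ∀ n, tvDist (a n) p = 2 * ∑' x, max (p x - a n x) 0 := by
    intro n
    have hs : Summable fun x => max (p x - a n x) 0 :=
      Summable.of_norm_bounded hp.summable (hdom n)
    have h3 := (hs.hasSum.mul_left 2).add ((ha n).sub hp)
    rw [sub_self, add_zero] at h3
    rw [← h3.tsum_eq, tvDist]
    refine tsum_congr fun x => ?_
    rcases le_total (p x) (a n x) with h | h
    · rw [abs_of_nonneg (by linarith), max_eq_right (by linarith)]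
      ring
    · rw [abs_of_nonpos (by linarith), max_eq_left (by linarith)]
      ring
  simp only [h2]
  simpa using h1.const_mul 2

theorem tvDist_triangle {a b c : S → ℝ} (ha : Summable a) (hb : Summable b) (hc : Summable c) :
    tvDist a b ≤ tvDist a c + tvDist b c := by
  have hac := (ha.sub hc).abs
  have hbc := (hb.sub hc).abs
  rw [tvDist, tvDist, tvDist, ← hac.tsum_add hbc]
  refine (ha.sub hb).abs.tsum_le_tsum (fun x => ?_) (hac.add hbc)
  have := abs_sub_le (a x) (c x) (b x)
  rwa [abs_sub_comm (c x) (b x)] at this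

/-- Pointwise limits of a tight sequence of probability vectors are probability vectors. -/
theorem hasSum_one_of_tight {κ : Type*} {l : Filter κ} [l.NeBot] {a : κ → S → ℝ} {m : S → ℝ}
    (ha0 : ∀ n x, 0 ≤ a n x) (ha : ∀ n, HasSum (a n) 1)
    (htight : ∀ ε > 0, ∃ s : Finset S, ∀ n, 1 - ε ≤ ∑ x ∈ s, a n x)
    (hlim : ∀ x, Tendsto (fun n => a n x) l (𝓝 (m x))) : HasSum m 1 := by
  have hfin : ∀ s : Finset S, Tendsto (fun n => ∑ x ∈ s, a n x) l (𝓝 (∑ x ∈ s, m x)) :=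
    fun s => tendsto_finsetSum s fun x _ => hlim x
  have hm0 : ∀ x, 0 ≤ m x := fun x => ge_of_tendsto' (hlim x) fun n => ha0 n x
  refine hasSum_of_isLUB_of_nonneg 1 hm0 ⟨?_, fun B hB => le_of_forall_pos_le_add fun ε hε => ?_⟩
  · rintro _ ⟨s, rfl⟩
    exact le_of_tendsto' (hfin s) fun n => sum_le_hasSum s (fun x _ => ha0 n x) (ha n)
  · obtain ⟨s, hs⟩ := htight ε hε
    have h1 := ge_of_tendsto' (hfin s) hs
    have h2 := hB ⟨s, rfl⟩
    simp only at h2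
    linarith

end TotalVariation

variable {ι : Type*} [Fintype ι] [DecidableEq ι]

theorem IsHessenbergGenerator.tight {Q : ℕ → ℕ → Matrix ι ι ℝ} (hQ : IsHessenbergGenerator Q)
    {V : ℕ → ℝ} {B : ℝ} (hV0 : ∀ k, 0 ≤ V k) (hV : ∀ k : ℕ, (k : ℝ) ≤ V k) {j : ℕ → ι}
    (hB : ∀ n, ∑' x, approx Q j n x * V x.1 ≤ B) {ε : ℝ} (hε : 0 < ε) :
    ∃ s : Finset (ℕ × ι), ∀ n, 1 - ε ≤ ∑ x ∈ s, approx Q j n x := by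
  -- Markov's inequality: the mass above level `N` is at most `B / (N + 1) ≤ ε`.
  obtain ⟨N, hN⟩ := exists_nat_ge (B / ε)
  refine ⟨Finset.range (N + 1) ×ˢ Finset.univ, fun n => ?_⟩
  set s : Finset (ℕ × ι) := Finset.range (N + 1) ×ˢ Finset.univ with hs
  have hN0 : (0 : ℝ) < ((N + 1 : ℕ) : ℝ) := by positivity
  have h1 := hQ.hasSum_approx j n
  have h2 := (hasSum_approx_mul (Q := Q) j n (fun x => V x.1))
  have h3 : HasSum (fun x => if x ∈ s then approx Q j n x else 0) (∑ x ∈ s, approx Q j n x) := by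
    rw [← Finset.sum_congr rfl fun x hx => if_pos (c := x ∈ s) (e := (0 : ℝ)) hx]
    exact hasSum_sum_of_ne_finset_zero fun x hx => if_neg hx
  have h4 := (h1.sub h3).mul_left ((N + 1 : ℕ) : ℝ)
  have h5 : ((N + 1 : ℕ) : ℝ) * (1 - ∑ x ∈ s, approx Q j n x) ≤ B := by
    refine (hasSum_le (fun x => ?_) h4 (h2.summable.hasSum)).trans (hB n)
    have ha := hQ.approx_nonneg j n x
    split_ifs with hx
    · rw [sub_self, mul_zero]
      exact mul_nonneg ha (hV0 _)
    · rw [sub_zero, mul_comm]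
      refine mul_le_mul_of_nonneg_left (le_trans ?_ (hV _)) ha
      have : ¬ x.1 < N + 1 := by simpa [hs] using hx
      exact_mod_cast not_lt.1 this
  have h6 : B ≤ ((N + 1 : ℕ) : ℝ) * ε := by
    rw [div_le_iff₀ hε] at hN
    push_cast
    linarith
  have h7 := le_of_mul_le_mul_left (h5.trans h6) hN0
  linarith

/-- Pointwise limits of approximations that are tight are stationary. -/
theorem IsHessenbergGenerator.isStationaryDistribution_of_tendsto
    {Q : ℕ → ℕ → Matrix ι ι ℝ} (hQ : IsHessenbergGenerator Q) {l : Filter ℕ} [l.NeBot]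
    (hl : l ≤ atTop) {V : ℕ → ℝ} {B : ℝ} (hV0 : ∀ k, 0 ≤ V k) (hV : ∀ k : ℕ, (k : ℝ) ≤ V k)
    {j : ℕ → ι} (hB : ∀ n, ∑' x, approx Q j n x * V x.1 ≤ B) {m : ℕ × ι → ℝ}
    (hlim : ∀ x, Tendsto (fun n => approx Q j n x) l (𝓝 (m x))) :
    IsStationaryDistribution (ofBlocks Q) m ∧ Summable fun x => m x * V x.1 := by
  have hm0 : ∀ x, 0 ≤ m x := fun x => ge_of_tendsto' (hlim x) fun n => hQ.approx_nonneg j n x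
  refine ⟨⟨hm0, hasSum_one_of_tight (hQ.approx_nonneg j) (hQ.hasSum_approx j)
    (fun ε hε => hQ.tight hV0 hV hB hε) hlim, fun y => ?_⟩, ?_⟩
  -- A Hessenberg column lives on levels up to `y.1 + 1`, so the balance equation is a finite sum
  -- and passes to the limit.
  · set s : Finset (ℕ × ι) := Finset.range (y.1 + 2) ×ˢ Finset.univ with hs
    have hzero : ∀ x ∉ s, ofBlocks Q x y = 0 := by
      intro x hx
      have : ¬ x.1 < y.1 + 2 := by simpa [hs] using hx
      simp only [ofBlocks]
      rw [hQ.eq_zero _ _ (by omega)]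
      rfl
    have hfin : ∀ a : ℕ × ι → ℝ, HasSum (fun x => a x * ofBlocks Q x y)
        (∑ x ∈ s, a x * ofBlocks Q x y) := fun a =>
      hasSum_sum_of_ne_finset_zero fun x hx => by rw [hzero x hx, mul_zero]
    have h1 : Tendsto (fun n => ∑ x ∈ s, approx Q j n x * ofBlocks Q x y) l
        (𝓝 (∑ x ∈ s, m x * ofBlocks Q x y)) :=
      tendsto_finsetSum s fun x _ => (hlim x).mul_const _
    have h2 : ∀ᶠ n in l, ∑ x ∈ s, approx Q j n x * ofBlocks Q x y = 0 :=
      hl ((eventually_gt_atTop y.1).mono fun n hn =>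
        (hfin _).unique (hQ.approx_balance j hn))
    have h3 : ∑ x ∈ s, m x * ofBlocks Q x y = 0 :=
      tendsto_nhds_unique h1 ((tendsto_congr' h2).2 tendsto_const_nhds)
    exact h3 ▸ hfin m
  · refine summable_of_sum_le (c := B) (fun x => mul_nonneg (hm0 x) (hV0 _)) fun s => ?_
    refine le_of_tendsto' (tendsto_finsetSum s fun x _ => (hlim x).mul_const (V x.1)) fun n => ?_
    have h := (hasSum_approx_mul (Q := Q) j n (fun x => V x.1)).summable
    exact (h.sum_le_tsum s fun x _ => mul_nonneg (hQ.approx_nonneg j n x) (hV0 _)).trans (hB n)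

/-- Compactness of `[0, 1]` in each coordinate; ultrafilters replace a diagonal extraction of
subsequences. -/
theorem IsHessenbergGenerator.exists_tendsto_ultrafilter {Q : ℕ → ℕ → Matrix ι ι ℝ}
    (hQ : IsHessenbergGenerator Q) (j : ℕ → ι) (l : Ultrafilter ℕ) :
    ∃ m : ℕ × ι → ℝ, ∀ x, Tendsto (fun n => approx Q j n x) l (𝓝 (m x)) := by
  have h : ∀ x, ∃ a, Tendsto (fun n => approx Q j n x) l (𝓝 a) := fun x => by
    have hmem : ∀ n, approx Q j n x ∈ Set.Icc (0 : ℝ) 1 := fun n =>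
      ⟨hQ.approx_nonneg j n x,
        le_hasSum (hQ.hasSum_approx j n) x fun y _ => hQ.approx_nonneg j n y⟩
    obtain ⟨a, -, ha⟩ := isCompact_Icc.ultrafilter_le_nhds
      (l.map fun n => approx Q j n x) (by
        rw [le_principal_iff]
        exact Filter.mem_map.2 (univ_mem' hmem))
    exact ⟨a, ha⟩
  choose m hm using h
  exact ⟨m, hm⟩

end Limit

/-! ### Existence, moments and convergence of the algorithm. -/

section Main

variable {ι : Type*} [Fintype ι] [DecidableEq ι] {D : ℕ → Matrix ι ι ℝ} {μ C : ℝ}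

namespace HasBatchMoment

variable (hC : HasBatchMoment D C) (hD : IsBMAP D)
include hC hD

omit hC hD in
-- The diagonal is at most `(M + μ)(k + e)` in absolute value; times a logarithm this is a multiple
-- of `lyapV`.
theorem summable_mul_diag (hμ : 0 < μ) {p : ℕ × ι → ℝ} (hp : ∀ x, 0 ≤ p x)
    (hV : Summable fun x => p x * lyapV x.1) {g : ℕ × ι → ℝ} {c : ℝ} (hg0 : ∀ x, 0 ≤ g x)
    (hg : ∀ x, g x ≤ c * Real.log ((x.1 : ℝ) + Real.exp 1)) :
    Summable fun x => p x * |ofBlocks (bmapBlocks D μ) x x| * g x := by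
  set M : ℝ := ∑ i, |D 0 i i| with hM
  refine Summable.of_nonneg_of_le (fun x => mul_nonneg (mul_nonneg (hp x) (abs_nonneg _)) (hg0 x))
    (fun x => ?_) (hV.mul_left ((M + μ) * c))
  obtain ⟨k, i⟩ := x
  have hk : (0 : ℝ) ≤ k := k.cast_nonneg
  have he := two_lt_exp_one
  have hMi : |D 0 i i| ≤ M :=
    Finset.single_le_sum (f := fun i => |D 0 i i|) (fun _ _ => abs_nonneg _) (Finset.mem_univ i)
  have hM0 : 0 ≤ M := (abs_nonneg _).trans hMi
  have h1 : |ofBlocks (bmapBlocks D μ) (k, i) (k, i)| ≤ (M + μ) * (k + Real.exp 1) := by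
    have h2 : ofBlocks (bmapBlocks D μ) (k, i) (k, i) = D 0 i i - k * μ := by
      simp [ofBlocks, bmapBlocks_self]
    rw [h2]
    refine (abs_sub _ _).trans ?_
    rw [abs_of_nonneg (by positivity : 0 ≤ (k : ℝ) * μ)]
    nlinarith [mul_nonneg hM0 hk]
  have h2 := mul_le_mul h1 (hg (k, i)) (hg0 _) (by positivity)
  have h3 := mul_le_mul_of_nonneg_left h2 (hp (k, i))
  simp only [lyapV] at *
  linarith

theorem algorithmApplies (hμ : 0 < μ) {p : ℕ × ι → ℝ}
    (hp : IsStationaryDistribution (ofBlocks (bmapBlocks D μ)) p)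
    (hlim : ∀ j : ℕ → ι, ∀ x,
      Tendsto (fun n => approx (bmapBlocks D μ) j n x) atTop (𝓝 (p x)))
    {c : ℝ} (hc : 0 < c) : AlgorithmApplies (bmapBlocks D μ) (logVec c) p := by
  have hQ := hD.isHessenbergGenerator hμ
  have hconv : ∀ j : ℕ → ι,
      Tendsto (fun n => tvDist (approx (bmapBlocks D μ) j n) p) atTop (𝓝 0) := fun j =>
    tendsto_tvDist_of_pointwise (hQ.approx_nonneg j) (hQ.hasSum_approx j) hp.nonneg
      hp.hasSum_one (hlim j)
  have hv : ∀ x : ℕ × ι, c ≤ logVec c x := fun x =>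
    le_mul_of_one_le_right hc.le (one_le_log_add_exp_one x.1.cast_nonneg)
  refine ⟨fun n => (hQ.Ustar_spec n).1.1, hQ.uStar_pos, fun n k i hk => ?_, fun n i => ?_,
    fun j _ => hQ.approx_nonneg j, fun j _ => hQ.hasSum_approx j, fun j _ => hconv j,
    fun j _ ε hε _ N hN _ => ?_⟩
  · have h := hC.summable_of_le_lyapV hD i k
      (f := fun l => c * Real.log ((l : ℝ) + Real.exp 1)) hc.le
      (fun l => mul_nonneg hc.le (zero_le_one.trans (one_le_log_add_exp_one l.cast_nonneg)))
      fun l => mul_le_mul_of_nonneg_left (log_add_exp_one_le_lyapV l.cast_nonneg) hc.le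
    -- Batches carrying level `k` above `n` have size at least `n - k + 1`: the tail is the batch
    -- series shifted by `n - k`.
    rw [← summable_nat_add_iff (n - k)] at h
    refine h.congr fun m => ?_
    rw [tailTerm, bmapBlocks_of_lt (by omega), show n + 1 + m - k = m + (n - k) + 1 by omega]
    rw [show k + (m + (n - k) + 1) = n + 1 + m by omega]
    exact (mulVec_const_apply _ _ i).symm
  · refine add_pos_of_pos_of_nonneg (hc.trans_le (hv _)) (Finset.sum_nonneg fun k hk =>
      mulVec_apply_nonneg (hQ.Ustar_nonneg n k i) fun a => tsum_nonneg fun m => ?_)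
    refine mulVec_apply_nonneg (hQ.nonneg_of_ne _ _ ?_ a) fun b => hc.le.trans (hv _)
    have := Finset.mem_range.1 hk
    omega
  · have h1 : Tendsto (fun l => tvDist (approx (bmapBlocks D μ) j (N l)) p) atTop (𝓝 0) :=
      (hconv j).comp hN.tendsto_atTop
    obtain ⟨L, hL⟩ := eventually_atTop.1 (h1.eventually (gt_mem_nhds (half_pos hε)))
    -- With `L + 1`, both compared indices are at least `L`, hence each vector is within `ε / 2` of
    -- `p`.
    refine ⟨L + 1, by omega, ?_⟩
    have h2 := tvDist_triangle (hQ.hasSum_approx j (N (L + 1))).summable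
      (hQ.hasSum_approx j (N (L + 1 - 1))).summable hp.hasSum_one.summable
    have h3 := hL (L + 1) (by omega)
    have h4 := hL (L + 1 - 1) (by omega)
    linarith

theorem exists_stationary [Nonempty ι] (hμ : 0 < μ) (hC0 : 0 < C) :
    ∃ p : ℕ × ι → ℝ, IsStationaryDistribution (ofBlocks (bmapBlocks D μ)) p ∧
      (∀ p' : ℕ × ι → ℝ, IsStationaryDistribution (ofBlocks (bmapBlocks D μ)) p' → p' = p) ∧
      (∀ x, 0 < p x) ∧
      ∀ c : ℝ, 0 < c →
        MomentCondition (ofBlocks (bmapBlocks D μ)) p (logVec c) ∧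
        AlgorithmApplies (bmapBlocks D μ) (logVec c) p := by
  have hQ := hD.isHessenbergGenerator hμ
  obtain ⟨b, hb⟩ := hC.exists_truncated_drift hD hμ hC0
  have hB := hQ.tsum_approx_mul_le (V := fun k => lyapV k) (half_pos hμ) hb
  have hstat : ∀ (j : ℕ → ι) (l : Ultrafilter ℕ), (l : Filter ℕ) ≤ atTop →
      ∃ m : ℕ × ι → ℝ, (∀ x, Tendsto (fun n => approx (bmapBlocks D μ) j n x) l (𝓝 (m x))) ∧
        IsStationaryDistribution (ofBlocks (bmapBlocks D μ)) m ∧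
        Summable fun x => m x * lyapV x.1 := by
    intro j l hl
    obtain ⟨m, hm⟩ := hQ.exists_tendsto_ultrafilter j l
    exact ⟨m, hm, hQ.isStationaryDistribution_of_tendsto hl
      (fun k => zero_le_one.trans (one_le_lyapV k.cast_nonneg))
      (fun k => self_le_lyapV k.cast_nonneg) (hB j) hm⟩
  obtain ⟨p, -, hp, hpV⟩ := hstat (fun _ => Classical.arbitrary ι) (hyperfilter ℕ)
    Nat.hyperfilter_le_atTop
  have hoff : ∀ x y, x ≠ y → 0 ≤ ofBlocks (bmapBlocks D μ) x y :=
    fun _ _ => hD.ofBlocks_offDiag_nonneg hμ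
  have hirr := hD.isIrreducibleGenerator hμ
  have huniq : ∀ p' : ℕ × ι → ℝ,
      IsStationaryDistribution (ofBlocks (bmapBlocks D μ)) p' → p' = p := fun p' hp' => by
    refine (hp.unique hoff hD.hasSum_ofBlocks hirr hp' ?_).symm
    simpa using summable_mul_diag hμ hp.nonneg hpV (g := fun _ => 1) (c := 1)
      (fun _ => zero_le_one) fun x => by
        rw [one_mul]
        exact one_le_log_add_exp_one x.1.cast_nonneg
  refine ⟨p, hp, huniq, pos_of_isStationaryDistribution hoff hirr hp, fun c hc => ⟨?_, ?_⟩⟩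
  · exact summable_mul_diag hμ hp.nonneg hpV (fun x => mul_nonneg hc.le
      (zero_le_one.trans (one_le_log_add_exp_one x.1.cast_nonneg))) fun x => le_rfl
  · refine hC.algorithmApplies hD hμ hp (fun j x => ?_) hc
    -- Along each ultrafilter the limit is stationary, so it equals `p` by uniqueness.
    rw [tendsto_iff_ultrafilter]
    intro l hl
    obtain ⟨m, hm, hms, -⟩ := hstat j l hl
    exact huniq m hms ▸ hm x

end HasBatchMoment

end Main

end BlockHessenberg

theorem mainTheorem7 {ι : Type*} [Fintype ι] [DecidableEq ι] [Nonempty ι]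
    (D : ℕ → Matrix ι ι ℝ) (hD : BlockHessenberg.IsBMAP D) (μ : ℝ) (hμ : 0 < μ)
    (C : ℝ) (hC : 0 < C)
    (hsum : ∀ i, Summable (fun k : ℕ =>
      BlockHessenberg.lyapV ((k + 1 : ℕ) : ℝ) * (D (k + 1)).mulVec (fun _ => 1) i))
    (hlt : ∀ i, ∑' k : ℕ,
      BlockHessenberg.lyapV ((k + 1 : ℕ) : ℝ) * (D (k + 1)).mulVec (fun _ => 1) i < C) :
    (∃ K : ℕ, ∃ θ : ℝ, 0 < θ ∧ ∀ k : ℕ, K + 1 ≤ k → ∀ i : ι,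
      Summable (fun l : ℕ =>
        (BlockHessenberg.bmapBlocks D μ k l).mulVec (fun _ => BlockHessenberg.lyapV l) i) ∧
      ∑' l : ℕ, (BlockHessenberg.bmapBlocks D μ k l).mulVec
        (fun _ => BlockHessenberg.lyapV l) i ≤ -θ * BlockHessenberg.lyapV k ∧
      -θ * BlockHessenberg.lyapV k ≤ -1) ∧
    (∀ c : ℝ, 1 < c * μ →
      BlockHessenberg.DriftCondition
        (BlockHessenberg.ofBlocks (BlockHessenberg.bmapBlocks D μ))
        (BlockHessenberg.logVec c)) ∧
    (∃ p : ℕ × ι → ℝ,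
      BlockHessenberg.IsStationaryDistribution
        (BlockHessenberg.ofBlocks (BlockHessenberg.bmapBlocks D μ)) p ∧
      (∀ p' : ℕ × ι → ℝ, BlockHessenberg.IsStationaryDistribution
        (BlockHessenberg.ofBlocks (BlockHessenberg.bmapBlocks D μ)) p' → p' = p) ∧
      (∀ x, 0 < p x) ∧
      ∀ c : ℝ, 0 < c →
        BlockHessenberg.MomentCondition
          (BlockHessenberg.ofBlocks (BlockHessenberg.bmapBlocks D μ)) p
          (BlockHessenberg.logVec c) ∧
        BlockHessenberg.AlgorithmApplies (BlockHessenberg.bmapBlocks D μ)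
          (BlockHessenberg.logVec c) p) := by
  have hB : BlockHessenberg.HasBatchMoment D C := ⟨hsum, hlt⟩
  exact ⟨hB.exists_lyapV_drift hD hμ hC, fun c hc => hB.driftCondition hD hμ hC hc,
    hB.exists_stationary hD hμ hC⟩
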